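/- Theorem 5.1 (Comparison principle). Let $E$ and $U_0$ be separable real Hilbert spaces. Let $C\subset E\times E$ be a possibly multivalued operator that is $m$-dissipative, i.e. $\langle x_1-x_2,y_1-y_2\rangle\le 0$ for all $(x_1,y_1),(x_2,y_2)\in C$ and $\mathcal R(I-aC)=E$ for all $a>0$. Assume that $\mathcal D(C)$ is dense in $E$ and $(0,0)\in C$. Denote by $C^0\xi$ the element of minimal norm of $C\xi$ for $\xi\in\mathcal D(C)$, by $S(t)x=\lim_{n\to\infty}(I-\frac tn C)^{-n}x$ the semigroup generated by $C$, and let $$d_C(x,y)=\inf_{t\ge 0}\big(t+\|x-S(t)y\|\big),\qquad x,y\in E.$$ Let $F:E\to E$ and, for each $x\in E$, a bounded linear operator $B(x):U_0\to E$ be given with $$\sup_{x\ne y}\frac{\|F(x)-F(y)\|+\|B(x)-B(y)\|}{\|x-y\|}<\infty$$ (operator norm for $B$), and put $G(x,p)=\langle F(x),p\rangle+\tfrac12\|B^*(x)p\|_{U_0}^2$. For $\mu,\rho>0$, $\xi\in\mathcal D(C)$, $y\in E$, the operator $\hat H_0$ assigns to the function $f(x)=\frac\mu2\|x-\xi\|^2+\rho\,d_C(x,y)$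 the function $$\hat H_0f(x)=\mu\langle x-\xi,C^0\xi\rangle+\rho+\sup_{\|q\|\le\rho}G\big(x,\mu(x-\xi)+q\big),$$ and $\hat H_1$ assigns to $f(x)=-\frac\mu2\|x-\xi\|^2-\rho\,d_C(x,y)$ the function $$\hat H_1f(x)=-\mu\langle x-\xi,C^0\xi\rangle-\rho+\inf_{\|q\|\le\rho}G\big(x,-\mu(x-\xi)+q\big);$$ $\hat H_0$ and $\hat H_1$ are understood as graphs, i.e. as the sets of all pairs $(f,\hat H_if)$ so obtained. Let $\alpha>0$ and let $h:E\to\mathbb R$ be bounded and uniformly continuous. For a function $g$ on $E$ write $g^*(x)=\limsup_{y\to x}g(y)$ and $g_*(x)=\liminf_{y\to x}g(y)$. Let $\bar f$ be a subsolution of $(I-\alpha\hat H_0)f=h$: $\bar f$ is bounded and upper semicontinuous, and whenever $f_0\in\mathcal D(\hat H_0)$ and $x_0\in E$ satisfy $(\bar f-f_0)(x_0)=\sup_E(\bar f-f_0)$, then $\alpha^{-1}(\bar f-h)(x_0)\le(\hat H_0f_0)^*(x_0)$. Let $\underline f$ be a supersolution of $(I-\alpha\hat H_1)f=h$: $\underline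 f$ is bounded and lower semicontinuous, and whenever $f_0\in\mathcal D(\hat H_1)$ and $x_0\in E$ satisfy $(f_0-\underline f)(x_0)=\sup_E(f_0-\underline f)$, then $\alpha^{-1}(\underline f-h)(x_0)\ge(\hat H_1f_0)_*(x_0)$. Then $\bar f\le\underline f$ on $E$. -/

import Mathlib

open Set Filter Topology

namespace HilbertHJ

section Operators

variable {E : Type*} [NormedAddCommGroup E] [InnerProductSpace ℝ E]

/-- The domain of a possibly multivalued operator, identified with its graph `C ⊆ E × E`. -/
def domain (C : Set (E × E)) : Set E := {x | ∃ y, (x, y) ∈ C}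

/-- `C` is m-dissipative: it is dissipative and `I - a C` has range `E` for every `a > 0`. -/
structure IsMDissipative (C : Set (E × E)) : Prop where
  dissipative : ∀ p ∈ C, ∀ q ∈ C, inner ℝ (p.1 - q.1) (p.2 - q.2) ≤ 0
  range_eq : ∀ a : ℝ, 0 < a → ∀ x : E, ∃ p ∈ C, p.1 - a • p.2 = x

/-- `‖C x‖ = inf {‖y‖ : (x, y) ∈ C}` (only meaningful for `x` in the domain of `C`). -/
noncomputable def minNorm (C : Set (E × E)) (x : E) : ℝ :=
  sInf {r : ℝ | ∃ y, (x, y) ∈ C ∧ r = ‖y‖}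

/-- The canonical restriction `C⁰` of `C`, as a graph: `z = C⁰ x` when `z` is an element of `C x`
of minimal norm. -/
def canonicalRestriction (C : Set (E × E)) : Set (E × E) :=
  {p | p ∈ C ∧ ‖p.2‖ = minNorm C p.1}

open Classical in
/-- The resolvent `(I - a C)⁻¹ x`: the point `z` with `z - a w = x` for some `(z, w) ∈ C`. For
m-dissipative `C` and `a > 0` it exists and is unique. At `a = 0` this is the identity, on
the domain of `C` by definition and elsewhere by the convention of the `else` branch. -/
noncomputable def resolvent (C : Set (E × E)) (a : ℝ) (x : E) : E :=
  if hx : ∃ z w, (z, w) ∈ C ∧ z - a • w = x then hx.choose else x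

/-- The semigroup generated by `C`, by the exponential formula
`S(t) x = lim_{n → ∞} (I - (t / n) C)^{-n} x`, for `t ≥ 0`. -/
noncomputable def semigroup (C : Set (E × E)) (t : ℝ) (x : E) : E :=
  limUnder atTop (fun n : ℕ => (resolvent C (t / n))^[n] x)

/-- The Tataru distance function `d_C(x, y) = inf {t + ‖x - S(t) y‖ : t ≥ 0}`. -/
noncomputable def tataruDist (C : Set (E × E)) (x y : E) : ℝ :=
  sInf {r : ℝ | ∃ t : ℝ, 0 ≤ t ∧ r = t + ‖x - semigroup C t y‖}

end Operators

section Viscosity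

variable {X : Type*} [TopologicalSpace X]

/-- The upper semicontinuous smoothing `g^*(x) = limsup_{y → x} g(y)`. -/
noncomputable def upperEnvelope (g : X → ℝ) (x : X) : EReal :=
  limsup (fun y => (g y : EReal)) (𝓝 x)

/-- The lower semicontinuous smoothing `g_*(x) = liminf_{y → x} g(y)`. -/
noncomputable def lowerEnvelope (g : X → ℝ) (x : X) : EReal :=
  liminf (fun y => (g y : EReal)) (𝓝 x)

/-- `f` is a viscosity subsolution (in the sense of Tataru, Crandall and Lions) of
`(I - α H) f = h`; the operator `H` is given by its graph. -/
structure IsSubsolution (H : Set ((X → ℝ) × (X → ℝ))) (α : ℝ) (h f : X → ℝ) : Prop where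
  bounded : ∃ M : ℝ, ∀ x, |f x| ≤ M
  usc : UpperSemicontinuous f
  le_of_max : ∀ p ∈ H, ∀ x₀ : X, (∀ x, f x - p.1 x ≤ f x₀ - p.1 x₀) →
    ((α⁻¹ * (f x₀ - h x₀) : ℝ) : EReal) ≤ upperEnvelope p.2 x₀

/-- `f` is a viscosity supersolution (in the sense of Tataru, Crandall and Lions) of
`(I - α H) f = h`; the operator `H` is given by its graph. -/
structure IsSupersolution (H : Set ((X → ℝ) × (X → ℝ))) (α : ℝ) (h f : X → ℝ) : Prop where
  bounded : ∃ M : ℝ, ∀ x, |f x| ≤ M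
  lsc : LowerSemicontinuous f
  ge_of_max : ∀ p ∈ H, ∀ x₀ : X, (∀ x, p.1 x - f x ≤ p.1 x₀ - f x₀) →
    lowerEnvelope p.2 x₀ ≤ ((α⁻¹ * (f x₀ - h x₀) : ℝ) : EReal)

end Viscosity

section Hamiltonian

variable {E U : Type*} [NormedAddCommGroup E] [InnerProductSpace ℝ E] [CompleteSpace E]
  [NormedAddCommGroup U] [InnerProductSpace ℝ U] [CompleteSpace U]

/-- `G(x, p) = ⟨F(x), p⟩ + ½ ‖B*(x) p‖²`. -/
noncomputable def hamiltonian (F : E → E) (B : E → U →L[ℝ] E) (x p : E) : ℝ :=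
  inner ℝ (F x) p + 1 / 2 * ‖ContinuousLinearMap.adjoint (B x) p‖ ^ 2

/-- The operator `Ĥ₀`, as a graph. A test function is `f = g + ρ d_C(·, y)` with
`g(x) = (μ / 2) ‖x - ξ‖²`, `Dg(x) = μ (x - ξ)` and `ξ` in the domain of `C`; in the formula
`η` is `C⁰ ξ`. -/
def opHat₀ (C : Set (E × E)) (F : E → E) (B : E → U →L[ℝ] E) : Set ((E → ℝ) × (E → ℝ)) :=
  {p | ∃ (μ ρ : ℝ) (ξ η y : E), 0 < μ ∧ 0 < ρ ∧ (ξ, η) ∈ canonicalRestriction C ∧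
    p.1 = (fun x => μ / 2 * ‖x - ξ‖ ^ 2 + ρ * tataruDist C x y) ∧
    p.2 = (fun x => μ * inner ℝ (x - ξ) η + ρ +
      ⨆ q : Metric.closedBall (0 : E) ρ, hamiltonian F B x (μ • (x - ξ) + (q : E)))}

/-- The operator `Ĥ₁`, as a graph. A test function is `f = g - ρ d_C(·, y)` with
`g(x) = -(μ / 2) ‖x - ξ‖²`, `Dg(x) = -μ (x - ξ)` and `ξ` in the domain of `C`; in the formula
`η` is `C⁰ ξ`. -/
def opHat₁ (C : Set (E × E)) (F : E → E) (B : E → U →L[ℝ] E) : Set ((E → ℝ) × (E → ℝ)) :=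
  {p | ∃ (μ ρ : ℝ) (ξ η y : E), 0 < μ ∧ 0 < ρ ∧ (ξ, η) ∈ canonicalRestriction C ∧
    p.1 = (fun x => -(μ / 2 * ‖x - ξ‖ ^ 2) - ρ * tataruDist C x y) ∧
    p.2 = (fun x => -(μ * inner ℝ (x - ξ) η) - ρ +
      ⨅ q : Metric.closedBall (0 : E) ρ, hamiltonian F B x (-(μ • (x - ξ)) + (q : E)))}

/-- The values of `G(x, ·)` over a ball are bounded, so the supremum and the infimum in the
definitions of `Ĥ₀` and `Ĥ₁` are genuine ones. -/
theorem hamiltonian_bounded (F : E → E) (B : E → U →L[ℝ] E) (x v : E) (ρ : ℝ) :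
    ∃ M : ℝ, ∀ q : Metric.closedBall (0 : E) ρ, |hamiltonian F B x (v + (q : E))| ≤ M := by
  refine ⟨‖F x‖ * (‖v‖ + ρ) +
    1 / 2 * (‖ContinuousLinearMap.adjoint (B x)‖ * (‖v‖ + ρ)) ^ 2, fun q => ?_⟩
  have hq : ‖v + (q : E)‖ ≤ ‖v‖ + ρ :=
    (norm_add_le _ _).trans (by have := mem_closedBall_zero_iff.1 q.2; linarith)
  have h1 : |inner ℝ (F x) (v + (q : E))| ≤ ‖F x‖ * (‖v‖ + ρ) :=
    (abs_real_inner_le_norm _ _).trans (by gcongr)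
  have h2 : ‖ContinuousLinearMap.adjoint (B x) (v + (q : E))‖ ≤
      ‖ContinuousLinearMap.adjoint (B x)‖ * (‖v‖ + ρ) :=
    (ContinuousLinearMap.le_opNorm _ _).trans (by gcongr)
  unfold hamiltonian
  refine (abs_add_le _ _).trans (add_le_add h1 ?_)
  rw [abs_of_nonneg (by positivity)]
  gcongr

end Hamiltonian

end HilbertHJ

namespace HilbertHJ

/-! ### Resolvents and Yosida approximations of an m-dissipative operator. -/

section Resolvent

variable {E : Type*} [NormedAddCommGroup E] [InnerProductSpace ℝ E] {C : Set (E × E)}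

/-- The Yosida approximation `C_t x = (J_t x - x) / t`. -/
noncomputable def yosida (C : Set (E × E)) (t : ℝ) (x : E) : E := t⁻¹ • (resolvent C t x - x)

theorem resolvent_zero (x : E) : resolvent C 0 x = x := by
  unfold resolvent
  split_ifs with hx
  · obtain ⟨w, _, hw⟩ := hx.choose_spec
    simpa using hw
  · rfl

theorem resolvent_add_yosida {t : ℝ} (ht : 0 < t) (x : E) :
    resolvent C t x = x + t • yosida C t x := by
  simp [yosida, smul_smul, ht.ne']

namespace IsMDissipative

variable (hC : IsMDissipative C)
include hC

theorem resolvent_mem {t : ℝ} (ht : 0 < t) (x : E) : (resolvent C t x, yosida C t x) ∈ C := by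
  have hx : ∃ z w, (z, w) ∈ C ∧ z - t • w = x := by
    obtain ⟨p, hp, h⟩ := hC.range_eq t ht x
    exact ⟨p.1, p.2, hp, h⟩
  have hr : resolvent C t x = hx.choose := by
    unfold resolvent
    rw [dif_pos hx]
  obtain ⟨w, hw, h⟩ := hx.choose_spec
  have : yosida C t x = w := by
    rw [yosida, hr, inv_smul_eq_iff₀ ht.ne', sub_eq_iff_eq_add', ← sub_eq_iff_eq_add]
    exact h
  rwa [this, hr]

theorem norm_sub_le_norm_sub_smul {x y x' y' : E} (h : (x, y) ∈ C) (h' : (x', y') ∈ C) {t : ℝ}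
    (ht : 0 ≤ t) : ‖x - x'‖ ≤ ‖(x - t • y) - (x' - t • y')‖ := by
  have h1 := hC.dissipative _ h _ h'
  simp only at h1
  have h2 : (x - t • y) - (x' - t • y') = (x - x') - t • (y - y') := by
    rw [smul_sub]; abel
  rw [h2]
  refine le_of_sq_le_sq ?_ (norm_nonneg _)
  rw [norm_sub_sq_real (x - x'), inner_smul_right]
  nlinarith [mul_nonneg ht (neg_nonneg.2 h1), sq_nonneg ‖t • (y - y')‖]

theorem resolvent_eq {x y : E} (h : (x, y) ∈ C) {t : ℝ} (ht : 0 < t) :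
    resolvent C t (x - t • y) = x := by
  have h1 := hC.norm_sub_le_norm_sub_smul (hC.resolvent_mem ht (x - t • y)) h ht.le
  rw [resolvent_add_yosida ht] at h1
  rw [resolvent_add_yosida ht, ← sub_eq_zero, ← norm_le_zero_iff]
  simpa using h1

theorem norm_resolvent_sub_le {t : ℝ} (ht : 0 ≤ t) (x y : E) :
    ‖resolvent C t x - resolvent C t y‖ ≤ ‖x - y‖ := by
  rcases ht.eq_or_lt with rfl | ht
  · simp [resolvent_zero]
  · have h1 := hC.norm_sub_le_norm_sub_smul (hC.resolvent_mem ht x) (hC.resolvent_mem ht y) ht.le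
    refine h1.trans_eq ?_
    rw [resolvent_add_yosida ht x, resolvent_add_yosida ht y]
    simp

theorem norm_resolvent_iterate_sub_le {t : ℝ} (ht : 0 ≤ t) (n : ℕ) (x y : E) :
    ‖(resolvent C t)^[n] x - (resolvent C t)^[n] y‖ ≤ ‖x - y‖ := by
  induction n with
  | zero => simp
  | succ n ih =>
    rw [Function.iterate_succ_apply', Function.iterate_succ_apply']
    exact (hC.norm_resolvent_sub_le ht _ _).trans ih

theorem continuous_resolvent {t : ℝ} (ht : 0 ≤ t) : Continuous (resolvent C t) :=
  (LipschitzWith.of_dist_le_mul (K := 1) fun x y => by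
    simpa [dist_eq_norm] using hC.norm_resolvent_sub_le ht x y).continuous

theorem resolvent_apply_zero (h0 : ((0 : E), (0 : E)) ∈ C) {t : ℝ} (ht : 0 < t) :
    resolvent C t 0 = 0 := by
  simpa using hC.resolvent_eq h0 ht

theorem norm_yosida_sq_le_inner {x y : E} (h : (x, y) ∈ C) {t : ℝ} (ht : 0 < t) :
    ‖yosida C t x‖ ^ 2 ≤ inner ℝ (yosida C t x) y := by
  have h1 := hC.dissipative _ h _ (hC.resolvent_mem ht x)
  simp only [resolvent_add_yosida ht x] at h1
  rw [sub_add_cancel_left, inner_neg_left, inner_smul_left, inner_sub_right,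
    real_inner_self_eq_norm_sq] at h1
  have h2 : 0 ≤ t * (inner ℝ (yosida C t x) y - ‖yosida C t x‖ ^ 2) := by simpa using h1
  nlinarith [nonneg_of_mul_nonneg_right h2 ht]

theorem norm_yosida_le {x y : E} (h : (x, y) ∈ C) {t : ℝ} (ht : 0 < t) :
    ‖yosida C t x‖ ≤ ‖y‖ := by
  have h1 := (hC.norm_yosida_sq_le_inner h ht).trans (real_inner_le_norm _ _)
  by_contra! h2
  nlinarith [norm_nonneg y]

theorem norm_resolvent_sub_self_le {x y : E} (h : (x, y) ∈ C) {t : ℝ} (ht : 0 ≤ t) :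
    ‖resolvent C t x - x‖ ≤ t * ‖y‖ := by
  rcases ht.eq_or_lt with rfl | ht
  · simp [resolvent_zero]
  · rw [resolvent_add_yosida ht, add_sub_cancel_left, norm_smul, Real.norm_of_nonneg ht.le]
    gcongr
    exact hC.norm_yosida_le h ht

/-- Dissipativity at the two resolvent points gives ⟨C_s x, C_t x⟩ ≥ ‖C_t x‖². The result yields
both monotonicity of the norms and, once they are bounded, the Cauchy property as the parameter
tends to 0. -/
theorem norm_yosida_sub_sq_le {s t : ℝ} (hs : 0 < s) (hst : s ≤ t) (x : E) :
    ‖yosida C s x - yosida C t x‖ ^ 2 ≤ ‖yosida C s x‖ ^ 2 - ‖yosida C t x‖ ^ 2 := by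
  rcases hst.eq_or_lt with rfl | hst
  · simp
  have ht := hs.trans hst
  have h1 := hC.dissipative _ (hC.resolvent_mem hs x) _ (hC.resolvent_mem ht x)
  simp only [resolvent_add_yosida ht x, resolvent_add_yosida hs x] at h1
  set a := yosida C s x
  set b := yosida C t x
  rw [add_sub_add_left_eq_sub, inner_sub_left, inner_sub_right, inner_sub_right] at h1
  simp only [real_inner_smul_left, real_inner_self_eq_norm_sq, real_inner_comm a b] at h1
  rw [norm_sub_sq_real]
  have h3 := sq_nonneg ‖a - b‖
  rw [norm_sub_sq_real] at h3
  have h2 : 0 ≤ (t - s) * (inner ℝ a b - ‖b‖ ^ 2) := by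
    have := real_inner_comm a b
    nlinarith
  nlinarith [nonneg_of_mul_nonneg_right h2 (sub_pos.2 hst)]

/-- Maximality: the range condition provides a point of `C` with the same value of x - y as the
given limit point, and dissipativity, which passes to the closure, forces the two to coincide. -/
theorem isClosed : IsClosed C := by
  refine isClosed_of_closure_subset fun p hp => ?_
  obtain ⟨q, hq, h⟩ := hC.range_eq 1 one_pos (p.1 - p.2)
  have h1 : inner ℝ (p.1 - q.1) (p.2 - q.2) ≤ 0 := by
    have hcl : IsClosed {p : E × E | inner ℝ (p.1 - q.1) (p.2 - q.2) ≤ (0 : ℝ)} :=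
      isClosed_le (by fun_prop) (by fun_prop)
    exact hcl.closure_subset_iff.2 (fun p' hp' => hC.dissipative _ hp' _ hq) hp
  rw [one_smul] at h
  have h2 : p.2 - q.2 = p.1 - q.1 := by
    rw [sub_eq_sub_iff_add_eq_add] at h ⊢
    rw [add_comm, ← h, add_comm]
  rw [h2, real_inner_self_eq_norm_sq] at h1
  have h3 : p.1 - q.1 = 0 := by
    rw [← norm_eq_zero]; nlinarith [norm_nonneg (p.1 - q.1)]
  have : p = q := Prod.ext (sub_eq_zero.1 h3) (sub_eq_zero.1 (h2.trans h3))
  rwa [this]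

end IsMDissipative

/-- The points at which the difference quotients of the resolvent are bounded by `R`; for
m-dissipative `C` these are the `x` with `‖C⁰ x‖ ≤ R`. -/
def sublevel (C : Set (E × E)) (R : ℝ) : Set E := {x | ∀ t : ℝ, 0 < t → ‖yosida C t x‖ ≤ R}

namespace IsMDissipative

variable (hC : IsMDissipative C)
include hC

theorem isClosed_sublevel (R : ℝ) : IsClosed (sublevel C R) := by
  have : sublevel C R = ⋂ t : ℝ, ⋂ _ : 0 < t, {x | ‖yosida C t x‖ ≤ R} := by
    ext; simp [sublevel]
  rw [this]
  refine isClosed_iInter fun t => isClosed_iInter fun ht => isClosed_le ?_ continuous_const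
  have := hC.continuous_resolvent ht.le
  unfold yosida
  fun_prop

theorem mem_sublevel {x y : E} (h : (x, y) ∈ C) : x ∈ sublevel C ‖y‖ :=
  fun _ ht => hC.norm_yosida_le h ht

/-- The Yosida approximation at `x` belongs to `C` at the resolvent point. This invariance makes the
resolvents of `ξ` admissible competitors in the doubling. -/
theorem resolvent_mem_sublevel {R : ℝ} {x : E} (hx : x ∈ sublevel C R) {s : ℝ} (hs : 0 < s) :
    resolvent C s x ∈ sublevel C R :=
  fun _ ht => (hC.norm_yosida_le (hC.resolvent_mem hs x) ht).trans (hx s hs)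

theorem exists_tendsto_yosida [CompleteSpace E] {R : ℝ} {x : E} (hx : x ∈ sublevel C R) :
    ∃ y, (x, y) ∈ canonicalRestriction C ∧
      Tendsto (fun n : ℕ => yosida C (1 / ((n : ℝ) + 1)) x) atTop (𝓝 y) := by
  set t : ℕ → ℝ := fun n => 1 / ((n : ℝ) + 1) with ht
  have htpos : ∀ n, 0 < t n := fun n => Nat.one_div_pos_of_nat
  have hanti : Antitone t := fun m n hmn => Nat.one_div_le_one_div hmn
  set c : ℕ → E := fun n => yosida C (t n) x with hc
  have hle : ∀ m n, m ≤ n → ‖c n - c m‖ ^ 2 ≤ ‖c n‖ ^ 2 - ‖c m‖ ^ 2 := fun m n hmn =>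
    hC.norm_yosida_sub_sq_le (htpos n) (hanti hmn) x
  have hmono : Monotone fun n => ‖c n‖ ^ 2 := fun m n hmn => by
    have := hle m n hmn
    nlinarith [sq_nonneg ‖c n - c m‖]
  have hbdd : BddAbove (range fun n => ‖c n‖ ^ 2) := by
    refine ⟨R ^ 2, ?_⟩
    rintro _ ⟨n, rfl⟩
    have := hx (t n) (htpos n)
    simp only [hc]
    gcongr
  have hcau := (tendsto_atTop_ciSup hmono hbdd).cauchySeq
  have hcc : CauchySeq c := by
    rw [Metric.cauchySeq_iff'] at hcau ⊢
    intro ε hε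
    obtain ⟨N, hN⟩ := hcau (ε ^ 2) (by positivity)
    refine ⟨N, fun n hn => ?_⟩
    rw [dist_eq_norm]
    refine lt_of_pow_lt_pow_left₀ 2 hε.le ((hle N n hn).trans_lt ?_)
    exact (le_abs_self _).trans_lt (hN n hn)
  obtain ⟨y, hy⟩ := cauchySeq_tendsto_of_complete hcc
  have ht0 : Tendsto t atTop (𝓝 0) := tendsto_one_div_add_atTop_nhds_zero_nat
  have hxn : Tendsto (fun n => resolvent C (t n) x) atTop (𝓝 x) := by
    have h1 : Tendsto (fun n => x + t n • c n) atTop (𝓝 (x + (0 : ℝ) • y)) :=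
      tendsto_const_nhds.add (ht0.smul hy)
    rw [zero_smul, add_zero] at h1
    refine h1.congr fun n => (resolvent_add_yosida (htpos n) x).symm
  have hmem : (x, y) ∈ C := hC.isClosed.mem_of_tendsto (hxn.prodMk_nhds hy)
    (Eventually.of_forall fun n => hC.resolvent_mem (htpos n) x)
  refine ⟨y, ⟨hmem, le_antisymm ?_ ?_⟩, hy⟩
  · refine le_csInf ⟨_, y, hmem, rfl⟩ ?_
    rintro _ ⟨z, hz, rfl⟩
    exact le_of_tendsto hy.norm (Eventually.of_forall fun n => hC.norm_yosida_le hz (htpos n))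
  · exact csInf_le ⟨0, by rintro _ ⟨z, _, rfl⟩; exact norm_nonneg z⟩ ⟨y, hmem, rfl⟩

/-! ### The exponential formula -/

/-- Dissipativity is used with the step ab/(a + b), half the harmonic mean, for which the backward
steps from the two resolvents combine into a convex combination of differences. -/
theorem norm_resolvent_sub_resolvent_le {a b : ℝ} (ha : 0 < a) (hb : 0 < b) (x y : E) :
    ‖resolvent C a x - resolvent C b y‖ ≤ b / (a + b) * ‖x - resolvent C b y‖ +
      a / (a + b) * ‖resolvent C a x - y‖ := by
  have hs : 0 < a * b / (a + b) := by positivity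
  have key := hC.norm_sub_le_norm_sub_smul (hC.resolvent_mem ha x) (hC.resolvent_mem hb y) hs.le
  have h1 : (resolvent C a x - (a * b / (a + b)) • yosida C a x) -
      (resolvent C b y - (a * b / (a + b)) • yosida C b y) =
      (b / (a + b)) • (x - resolvent C b y) + (a / (a + b)) • (resolvent C a x - y) := by
    have e1 : a * b / (a + b) * a⁻¹ = b / (a + b) := by field_simp
    have e2 : a * b / (a + b) * b⁻¹ = a / (a + b) := by field_simp
    have e3 : a / (a + b) = 1 - b / (a + b) := by field_simp; ring
    simp only [yosida, smul_smul, e1, e2]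
    rw [e3]
    module
  rw [h1] at key
  refine key.trans ((norm_add_le _ _).trans_eq ?_)
  rw [norm_smul, norm_smul, Real.norm_of_nonneg (by positivity), Real.norm_of_nonneg (by positivity)]

theorem norm_resolvent_iterate_sub_self_le {x y : E} (h : (x, y) ∈ C) {a : ℝ} (ha : 0 ≤ a)
    (n : ℕ) : ‖(resolvent C a)^[n] x - x‖ ≤ n * a * ‖y‖ := by
  induction n with
  | zero => simp
  | succ n ih =>
    rw [Function.iterate_succ_apply]
    have h1 := hC.norm_resolvent_iterate_sub_le ha n (resolvent C a x) x
    have h2 := hC.norm_resolvent_sub_self_le h ha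
    calc _ ≤ _ := norm_sub_le_norm_sub_add_norm_sub _ ((resolvent C a)^[n] x) _
      _ ≤ a * ‖y‖ + n * a * ‖y‖ := add_le_add (h1.trans h2) ih
      _ = _ := by push_cast; ring

/-- Kobayashi's estimate for the iterates of the resolvent. -/
theorem norm_resolvent_iterate_sub_iterate_sq_le {x y : E} (h : (x, y) ∈ C) {a b : ℝ} (ha : 0 < a)
    (hb : 0 < b) (m n : ℕ) :
    ‖(resolvent C a)^[m] x - (resolvent C b)^[n] x‖ ^ 2 ≤
      ‖y‖ ^ 2 * ((m * a - n * b) ^ 2 + m * a ^ 2 + n * b ^ 2) := by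
  induction m generalizing n with
  | zero =>
    have h1 := hC.norm_resolvent_iterate_sub_self_le h hb.le n
    rw [norm_sub_rev] at h1
    have h2 := pow_le_pow_left₀ (norm_nonneg _) h1 2
    simp only [Function.iterate_zero, id, Nat.cast_zero]
    nlinarith [mul_nonneg (sq_nonneg ‖y‖) (mul_nonneg n.cast_nonneg' (sq_nonneg b))]
  | succ m ihm =>
    induction n with
    | zero =>
      have h1 := hC.norm_resolvent_iterate_sub_self_le h ha.le (m + 1)
      have h2 := pow_le_pow_left₀ (norm_nonneg _) h1 2
      simp only [Function.iterate_zero, id, Nat.cast_zero]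
      nlinarith [mul_nonneg (sq_nonneg ‖y‖) (mul_nonneg (m + 1).cast_nonneg' (sq_nonneg a))]
    | succ n ihn =>
      have h1 := ihm (n + 1)
      have h2 := hC.norm_resolvent_sub_resolvent_le ha hb ((resolvent C a)^[m] x)
        ((resolvent C b)^[n] x)
      simp only [← Function.iterate_succ_apply'] at h2
      set u := ‖(resolvent C a)^[m] x - (resolvent C b)^[n + 1] x‖
      set v := ‖(resolvent C a)^[m + 1] x - (resolvent C b)^[n] x‖
      set w := ‖(resolvent C a)^[m + 1] x - (resolvent C b)^[n + 1] x‖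
      set K := ‖y‖ ^ 2
      have e3 : a / (a + b) = 1 - b / (a + b) := by field_simp; ring
      have hw : 0 ≤ w := norm_nonneg _
      have hθ : 0 ≤ b / (a + b) := by positivity
      have hθ' : 0 ≤ a / (a + b) := by positivity
      have h3 : w ^ 2 ≤ b / (a + b) * u ^ 2 + a / (a + b) * v ^ 2 := by
        refine (pow_le_pow_left₀ hw h2 2).trans ?_
        rw [e3] at hθ' ⊢
        nlinarith [mul_nonneg (mul_nonneg hθ hθ') (sq_nonneg (u - v))]
      -- The bracket (ma - nb)² + ma² + nb² satisfies the averaging recursion with weights b/(a +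
      -- b), a/(a + b) with equality, so the induction closes without loss.
      refine h3.trans ((add_le_add (mul_le_mul_of_nonneg_left h1 hθ)
        (mul_le_mul_of_nonneg_left ihn hθ')).trans_eq ?_)
      push_cast
      field_simp
      ring

end IsMDissipative

end Resolvent

/-! ### The exponential formula and the contraction semigroup. -/

section Semigroup

variable {E : Type*} [NormedAddCommGroup E] [InnerProductSpace ℝ E] {C : Set (E × E)}

theorem semigroup_zero (x : E) : semigroup C 0 x = x := by
  have : ∀ n : ℕ, (resolvent C 0)^[n] x = x := fun n =>
    Function.iterate_fixed (resolvent_zero x) n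
  simp only [semigroup, zero_div, this]
  exact tendsto_const_nhds.limUnder_eq

theorem tendsto_floor_mul {t : ℝ} (ht : 0 ≤ t) :
    Tendsto (fun k : ℕ => ⌊t * ((k : ℝ) + 1)⌋₊ * (1 / ((k : ℝ) + 1))) atTop (𝓝 t) := by
  have h1 : Tendsto (fun k : ℕ => (k : ℝ) + 1) atTop atTop :=
    tendsto_natCast_atTop_atTop.atTop_add tendsto_const_nhds
  simpa [div_eq_mul_inv, Function.comp_def] using (tendsto_nat_floor_mul_div_atTop ht).comp h1

namespace IsMDissipative

variable (hC : IsMDissipative C)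
include hC

section Limits

variable [CompleteSpace E] (hdense : Dense (domain C))
include hdense

/-- The implicit Euler scheme converges at every point. -/
theorem exists_tendsto_resolvent_iterate {t : ℝ} (ht : 0 ≤ t) (x : E) :
    ∃ z, ∀ (a : ℕ → ℝ) (m : ℕ → ℕ), (∀ᶠ k in atTop, 0 < a k) → Tendsto a atTop (𝓝 0) →
      Tendsto (fun k => m k * a k) atTop (𝓝 t) →
      Tendsto (fun k => (resolvent C (a k))^[m k] x) atTop (𝓝 z) := by
  -- Two schemes are compared at once: taken equal they give the Cauchy property, taken different
  -- they show that the limit does not depend on the scheme. Kobayashi's estimate applies on the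
  -- domain; density and contractivity carry it to `x`.
  have key : ∀ (a b : ℕ → ℝ) (m n : ℕ → ℕ), (∀ᶠ k in atTop, 0 < a k) →
      (∀ᶠ k in atTop, 0 < b k) → Tendsto a atTop (𝓝 0) → Tendsto b atTop (𝓝 0) →
      Tendsto (fun k => m k * a k) atTop (𝓝 t) → Tendsto (fun k => n k * b k) atTop (𝓝 t) →
      ∀ ε : ℝ, 0 < ε → ∃ N, ∀ k, N ≤ k → ∀ l, N ≤ l →
        ‖(resolvent C (a k))^[m k] x - (resolvent C (b l))^[n l] x‖ < ε := by
    intro a b m n ha hb ha0 hb0 hm hn ε hε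
    obtain ⟨x', ⟨y, hy⟩, hx'⟩ := Metric.mem_closure_iff.1 (hdense x) (ε / 4) (by positivity)
    rw [dist_eq_norm] at hx'
    have hlim : Tendsto (fun p : ℕ × ℕ => ‖y‖ ^ 2 * ((m p.1 * a p.1 - n p.2 * b p.2) ^ 2 +
        m p.1 * a p.1 * a p.1 + n p.2 * b p.2 * b p.2)) (atTop ×ˢ atTop) (𝓝 0) := by
      have f1 := hm.comp (tendsto_fst (f := atTop) (g := (atTop : Filter ℕ)))
      have f2 := hn.comp (tendsto_snd (f := (atTop : Filter ℕ)) (g := atTop))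
      have f3 := ha0.comp (tendsto_fst (f := atTop) (g := (atTop : Filter ℕ)))
      have f4 := hb0.comp (tendsto_snd (f := (atTop : Filter ℕ)) (g := atTop))
      have := ((((f1.sub f2).pow 2).add (f1.mul f3)).add (f2.mul f4)).const_mul (‖y‖ ^ 2)
      simpa using this
    have hev := hlim.eventually (gt_mem_nhds (show (0 : ℝ) < (ε / 4) ^ 2 by positivity))
    have hab : ∀ᶠ p : ℕ × ℕ in atTop ×ˢ atTop, 0 < a p.1 ∧ 0 < b p.2 :=
      ha.prod_mk hb
    rw [prod_atTop_atTop_eq] at hev hab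
    obtain ⟨N, hN⟩ := eventually_atTop.1 (hev.and hab)
    refine ⟨max N.1 N.2, fun k hk l hl => ?_⟩
    obtain ⟨h1, ha', hb'⟩ := hN (k, l) ⟨(le_max_left _ _).trans hk, (le_max_right _ _).trans hl⟩
    have h2 := hC.norm_resolvent_iterate_sub_iterate_sq_le hy ha' hb' (m k) (n l)
    have h3 : ‖(resolvent C (a k))^[m k] x' - (resolvent C (b l))^[n l] x'‖ < ε / 4 := by
      refine lt_of_pow_lt_pow_left₀ 2 (by positivity) (h2.trans_lt (lt_of_eq_of_lt ?_ h1))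
      ring
    have h4 := hC.norm_resolvent_iterate_sub_le ha'.le (m k) x x'
    have h5 := hC.norm_resolvent_iterate_sub_le hb'.le (n l) x' x
    rw [norm_sub_rev x' x] at h5
    have h6 := norm_sub_le_norm_sub_add_norm_sub ((resolvent C (a k))^[m k] x)
      ((resolvent C (a k))^[m k] x') ((resolvent C (b l))^[n l] x)
    have h7 := norm_sub_le_norm_sub_add_norm_sub ((resolvent C (a k))^[m k] x')
      ((resolvent C (b l))^[n l] x') ((resolvent C (b l))^[n l] x)
    linarith
  set a₀ : ℕ → ℝ := fun k => 1 / ((k : ℝ) + 1) with ha₀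
  set m₀ : ℕ → ℕ := fun k => ⌊t * ((k : ℝ) + 1)⌋₊ with hm₀
  have hpos : ∀ᶠ k in atTop, 0 < a₀ k := Eventually.of_forall fun k => Nat.one_div_pos_of_nat
  have hlim0 : Tendsto a₀ atTop (𝓝 0) := tendsto_one_div_add_atTop_nhds_zero_nat
  have hlimt : Tendsto (fun k => m₀ k * a₀ k) atTop (𝓝 t) := tendsto_floor_mul ht
  have hcau : CauchySeq fun k => (resolvent C (a₀ k))^[m₀ k] x := by
    rw [Metric.cauchySeq_iff]
    intro ε hε
    obtain ⟨N, hN⟩ := key a₀ a₀ m₀ m₀ hpos hpos hlim0 hlim0 hlimt hlimt ε hε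
    exact ⟨N, fun k hk l hl => by rw [dist_eq_norm]; exact hN k hk l hl⟩
  obtain ⟨z, hz⟩ := cauchySeq_tendsto_of_complete hcau
  refine ⟨z, fun a m ha ha0 hm => ?_⟩
  have hd : Tendsto (fun k => (resolvent C (a k))^[m k] x - (resolvent C (a₀ k))^[m₀ k] x)
      atTop (𝓝 0) := by
    rw [Metric.tendsto_atTop]
    intro ε hε
    obtain ⟨N, hN⟩ := key a a₀ m m₀ ha hpos ha0 hlim0 hm hlimt ε hε
    exact ⟨N, fun k hk => by rw [dist_zero_right]; exact hN k hk k hk⟩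
  simpa using hd.add hz

theorem tendsto_semigroup {t : ℝ} (ht : 0 ≤ t) (x : E) {a : ℕ → ℝ} {m : ℕ → ℕ}
    (ha : ∀ᶠ k in atTop, 0 < a k) (ha0 : Tendsto a atTop (𝓝 0))
    (hm : Tendsto (fun k => m k * a k) atTop (𝓝 t)) :
    Tendsto (fun k => (resolvent C (a k))^[m k] x) atTop (𝓝 (semigroup C t x)) := by
  obtain ⟨z, hz⟩ := hC.exists_tendsto_resolvent_iterate hdense ht x
  -- At `t = 0` the steps in the definition of `semigroup` vanish and are not an admissible scheme;
  -- the scheme with zero iterations identifies the limit instead.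
  rcases ht.eq_or_lt with rfl | ht
  · rw [semigroup_zero]
    have h0 := hz (fun k => 1 / ((k : ℝ) + 1)) (fun _ => 0)
      (Eventually.of_forall fun k => Nat.one_div_pos_of_nat)
      tendsto_one_div_add_atTop_nhds_zero_nat (by simp)
    simp only [Function.iterate_zero, id] at h0
    have hxz : x = z := tendsto_nhds_unique tendsto_const_nhds h0
    have h1 := hz a m ha ha0 hm
    rwa [← hxz] at h1
  · have h1 : Tendsto (fun n : ℕ => (resolvent C (t / n))^[n] x) atTop (𝓝 z) := by
      refine hz (fun n => t / n) id ?_ (tendsto_const_div_atTop_nhds_zero_nat t) ?_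
      · filter_upwards [eventually_gt_atTop 0] with n hn
        have : (0 : ℝ) < n := by exact_mod_cast hn
        positivity
      · refine tendsto_const_nhds.congr' ?_
        filter_upwards [eventually_gt_atTop 0] with n hn
        have : (0 : ℝ) < n := by exact_mod_cast hn
        simp only [id]
        field_simp
    rw [semigroup, h1.limUnder_eq]
    exact hz a m ha ha0 hm

theorem norm_semigroup_sub_le {t : ℝ} (ht : 0 ≤ t) (x y : E) :
    ‖semigroup C t x - semigroup C t y‖ ≤ ‖x - y‖ := by
  have h1 : Tendsto (fun k : ℕ => 1 / ((k : ℝ) + 1)) atTop (𝓝 0) :=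
    tendsto_one_div_add_atTop_nhds_zero_nat
  have h2 : ∀ᶠ k : ℕ in atTop, 0 < 1 / ((k : ℝ) + 1) :=
    Eventually.of_forall fun k => Nat.one_div_pos_of_nat
  have h3 : Tendsto (fun k : ℕ => ⌊t * ((k : ℝ) + 1)⌋₊ * (1 / ((k : ℝ) + 1))) atTop (𝓝 t) :=
    tendsto_floor_mul ht
  exact le_of_tendsto ((hC.tendsto_semigroup hdense ht x h2 h1 h3).sub
    (hC.tendsto_semigroup hdense ht y h2 h1 h3)).norm
    (Eventually.of_forall fun k => hC.norm_resolvent_iterate_sub_le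
      (Nat.one_div_pos_of_nat).le _ _ _)

theorem semigroup_add {s t : ℝ} (hs : 0 ≤ s) (ht : 0 ≤ t) (x : E) :
    semigroup C (s + t) x = semigroup C s (semigroup C t x) := by
  set a : ℕ → ℝ := fun k => 1 / ((k : ℝ) + 1)
  have h1 : Tendsto a atTop (𝓝 0) := tendsto_one_div_add_atTop_nhds_zero_nat
  have h2 : ∀ᶠ k : ℕ in atTop, 0 < a k := Eventually.of_forall fun k => Nat.one_div_pos_of_nat
  have hs' : Tendsto (fun k : ℕ => ⌊s * ((k : ℝ) + 1)⌋₊ * a k) atTop (𝓝 s) :=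
    tendsto_floor_mul hs
  have ht' : Tendsto (fun k : ℕ => ⌊t * ((k : ℝ) + 1)⌋₊ * a k) atTop (𝓝 t) :=
    tendsto_floor_mul ht
  have hst : Tendsto (fun k : ℕ => ((⌊s * ((k : ℝ) + 1)⌋₊ + ⌊t * ((k : ℝ) + 1)⌋₊ : ℕ) : ℝ) * a k)
      atTop (𝓝 (s + t)) := by
    simpa [add_mul] using hs'.add ht'
  have l1 := hC.tendsto_semigroup hdense (add_nonneg hs ht) x h2 h1 hst
  have l2 := hC.tendsto_semigroup hdense ht x h2 h1 ht'
  have l3 := hC.tendsto_semigroup hdense hs (semigroup C t x) h2 h1 hs'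
  have l4 := tendsto_iff_norm_sub_tendsto_zero.1 l2
  have l5 := squeeze_zero_norm (fun k => (hC.norm_resolvent_iterate_sub_le
    (Nat.one_div_pos_of_nat (n := k) (α := ℝ)).le ⌊s * ((k : ℝ) + 1)⌋₊
      ((resolvent C (a k))^[⌊t * ((k : ℝ) + 1)⌋₊] x) (semigroup C t x))) l4
  have l6 := l5.add l3
  simp only [zero_add] at l6
  refine tendsto_nhds_unique l1 (l6.congr fun k => ?_)
  rw [Function.iterate_add_apply]
  exact sub_add_cancel _ _

theorem norm_semigroup_sub_semigroup_le {x y : E} (h : (x, y) ∈ C) {s t : ℝ} (hs : 0 ≤ s)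
    (ht : 0 ≤ t) : ‖semigroup C s x - semigroup C t x‖ ≤ ‖y‖ * |s - t| := by
  wlog hst : t ≤ s generalizing s t
  · rw [norm_sub_rev, abs_sub_comm]
    exact this ht hs (not_le.1 hst).le
  obtain ⟨r, hr, rfl⟩ : ∃ r, 0 ≤ r ∧ s = t + r := ⟨s - t, sub_nonneg.2 hst, by ring⟩
  rw [hC.semigroup_add hdense ht hr]
  refine (hC.norm_semigroup_sub_le hdense ht _ _).trans ?_
  have h1 : Tendsto (fun k : ℕ => 1 / ((k : ℝ) + 1)) atTop (𝓝 0) :=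
    tendsto_one_div_add_atTop_nhds_zero_nat
  have h2 : ∀ᶠ k : ℕ in atTop, 0 < 1 / ((k : ℝ) + 1) :=
    Eventually.of_forall fun k => Nat.one_div_pos_of_nat
  have h3 : Tendsto (fun k : ℕ => ⌊r * ((k : ℝ) + 1)⌋₊ * (1 / ((k : ℝ) + 1))) atTop (𝓝 r) :=
    tendsto_floor_mul hr
  have h4 := le_of_tendsto_of_tendsto' ((hC.tendsto_semigroup hdense hr x h2 h1 h3).sub_const x).norm
    (h3.mul_const ‖y‖) (fun k => hC.norm_resolvent_iterate_sub_self_le h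
      (Nat.one_div_pos_of_nat).le _)
  rwa [add_sub_cancel_left, abs_of_nonneg hr, mul_comm]

theorem continuousOn_semigroup (x : E) : ContinuousOn (fun t => semigroup C t x) (Ici 0) := by
  rw [Metric.continuousOn_iff]
  intro t ht ε hε
  obtain ⟨x', ⟨y, hy⟩, hx'⟩ := Metric.mem_closure_iff.1 (hdense x) (ε / 4) (by positivity)
  rw [dist_eq_norm] at hx'
  refine ⟨ε / (4 * (‖y‖ + 1)), by positivity, fun s hs hst => ?_⟩
  rw [Real.dist_eq, lt_div_iff₀ (by positivity)] at hst
  rw [dist_eq_norm]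
  have h1 := hC.norm_semigroup_sub_le hdense hs x x'
  have h2 := hC.norm_semigroup_sub_le hdense ht x' x
  have h3 := hC.norm_semigroup_sub_semigroup_le hdense hy hs ht
  rw [norm_sub_rev x' x] at h2
  have h6 := norm_sub_le_norm_sub_add_norm_sub (semigroup C s x) (semigroup C s x')
    (semigroup C t x)
  have h7 := norm_sub_le_norm_sub_add_norm_sub (semigroup C s x') (semigroup C t x')
    (semigroup C t x)
  nlinarith [abs_nonneg (s - t)]

end Limits

end IsMDissipative

end Semigroup

/-! ### The Tataru distance: triangle inequality and completeness. -/

section Tataru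

variable {E : Type*} [NormedAddCommGroup E] [InnerProductSpace ℝ E] {C : Set (E × E)}

theorem tataruDist_le {t : ℝ} (ht : 0 ≤ t) (x y : E) :
    tataruDist C x y ≤ t + ‖x - semigroup C t y‖ :=
  csInf_le ⟨0, by rintro _ ⟨t, ht, rfl⟩; positivity⟩ ⟨t, ht, rfl⟩

theorem le_tataruDist {x y : E} {r : ℝ} (h : ∀ t : ℝ, 0 ≤ t → r ≤ t + ‖x - semigroup C t y‖) :
    r ≤ tataruDist C x y :=
  le_csInf ⟨_, 0, le_rfl, rfl⟩ (by rintro _ ⟨t, ht, rfl⟩; exact h t ht)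

theorem tataruDist_nonneg (x y : E) : 0 ≤ tataruDist C x y :=
  le_tataruDist fun t ht => by positivity

theorem exists_of_tataruDist_lt {x y : E} {r : ℝ} (h : tataruDist C x y < r) :
    ∃ t : ℝ, 0 ≤ t ∧ t + ‖x - semigroup C t y‖ < r := by
  by_contra! h'
  exact h.not_ge (le_tataruDist h')

theorem tataruDist_sub_le (x x' y : E) : tataruDist C x y ≤ tataruDist C x' y + ‖x - x'‖ := by
  rw [← sub_le_iff_le_add]
  refine le_tataruDist fun t ht => ?_
  have h1 := tataruDist_le (C := C) ht x y
  have h2 := norm_sub_le_norm_sub_add_norm_sub x x' (semigroup C t y)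
  linarith

theorem continuous_tataruDist (y : E) : Continuous fun x => tataruDist C x y :=
  (LipschitzWith.of_le_add fun x x' => by
    rw [dist_eq_norm]; exact tataruDist_sub_le x x' y).continuous

theorem tataruDist_self (x : E) : tataruDist C x x = 0 :=
  le_antisymm (by simpa [semigroup_zero] using tataruDist_le (C := C) le_rfl x x)
    (tataruDist_nonneg x x)

namespace IsMDissipative

variable (hC : IsMDissipative C) [CompleteSpace E] (hdense : Dense (domain C))
include hC hdense

theorem tataruDist_triangle (x y z : E) :
    tataruDist C x z ≤ tataruDist C x y + tataruDist C y z := by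
  rw [← sub_le_iff_le_add']
  refine le_tataruDist fun t ht => ?_
  rw [sub_le_comm]
  refine le_tataruDist fun s hs => ?_
  have h1 := tataruDist_le (C := C) (add_nonneg hs ht) x z
  rw [hC.semigroup_add hdense hs ht] at h1
  have h2 := hC.norm_semigroup_sub_le hdense hs y (semigroup C t z)
  have h3 := norm_sub_le_norm_sub_add_norm_sub x (semigroup C s y)
    (semigroup C s (semigroup C t z))
  linarith

/-- Each step is a flow for a time `t n` plus a jump, both geometrically small. The total time `T`
converges, and contractivity keeps `z m` within the sum of the later jumps of S(T m - T n) z n. For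
fixed `n` the latter is Cauchy in `m` by strong continuity, hence so is `z`. -/
theorem exists_tendsto_of_tataruDist_le {z : ℕ → E} {c : ℝ}
    (hz : ∀ n, tataruDist C (z (n + 1)) (z n) ≤ c * (1 / 2) ^ n) :
    ∃ a, Tendsto z atTop (𝓝 a) := by
  have hlt : ∀ n, tataruDist C (z (n + 1)) (z n) < (c + 1) * (1 / 2) ^ n := fun n =>
    (hz n).trans_lt (by have : (0 : ℝ) < (1 / 2) ^ n := by positivity
                        nlinarith)
  choose t ht htz using fun n => exists_of_tataruDist_lt (hlt n)
  have hc : 0 < c + 1 := by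
    have := (tataruDist_nonneg _ _).trans_lt (hlt 0)
    simpa using this
  set T : ℕ → ℝ := fun n => ∑ i ∈ Finset.range n, t i with hT
  have hTmono : Monotone T := fun m n hmn =>
    Finset.sum_le_sum_of_subset_of_nonneg (Finset.range_subset_range.2 hmn) fun i _ _ => ht i
  have hTdiff : ∀ n k, T (n + k) - T n ≤ 2 * (c + 1) * ((1 / 2) ^ n - (1 / 2) ^ (n + k)) := by
    intro n k
    induction k with
    | zero => simp
    | succ k ih =>
      have h1 : T (n + (k + 1)) = T (n + k) + t (n + k) := Finset.sum_range_succ _ _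
      have h2 := htz (n + k)
      have h3 := norm_nonneg (z (n + k + 1) - semigroup C (t (n + k)) (z (n + k)))
      rw [h1, ← add_assoc, pow_succ _ (n + k)]
      nlinarith
  have hzdiff : ∀ n k, ‖z (n + k) - semigroup C (T (n + k) - T n) (z n)‖ ≤
      2 * (c + 1) * ((1 / 2) ^ n - (1 / 2) ^ (n + k)) := by
    intro n k
    induction k with
    | zero => simp [semigroup_zero]
    | succ k ih =>
      have h1 : T (n + (k + 1)) - T n = t (n + k) + (T (n + k) - T n) := by
        have : T (n + (k + 1)) = T (n + k) + t (n + k) := Finset.sum_range_succ _ _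
        rw [this]; ring
      have h2 := htz (n + k)
      have h3 := ht (n + k)
      rw [h1, hC.semigroup_add hdense h3 (sub_nonneg.2 (hTmono (Nat.le_add_right n k)))]
      have h4 := hC.norm_semigroup_sub_le hdense h3 (z (n + k))
        (semigroup C (T (n + k) - T n) (z n))
      have h5 := norm_sub_le_norm_sub_add_norm_sub (z (n + k + 1))
        (semigroup C (t (n + k)) (z (n + k)))
        (semigroup C (t (n + k)) (semigroup C (T (n + k) - T n) (z n)))
      rw [← add_assoc, pow_succ _ (n + k)]
      nlinarith
  have hTbdd : BddAbove (range T) := by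
    refine ⟨2 * (c + 1), ?_⟩
    rintro _ ⟨n, rfl⟩
    have h1 := hTdiff 0 n
    have h2 : (0 : ℝ) < (1 / 2) ^ n := by positivity
    simp only [zero_add, hT, Finset.sum_range_zero, pow_zero] at h1 ⊢
    nlinarith
  have hTlim := tendsto_atTop_ciSup hTmono hTbdd
  refine cauchySeq_tendsto_of_complete (Metric.cauchySeq_iff'.2 fun ε hε => ?_)
  obtain ⟨n, hn⟩ : ∃ n : ℕ, 2 * (c + 1) * (1 / 2) ^ n < ε / 3 := by
    have : Tendsto (fun n : ℕ => 2 * (c + 1) * (1 / 2 : ℝ) ^ n) atTop (𝓝 (2 * (c + 1) * 0)) :=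
      (tendsto_pow_atTop_nhds_zero_of_lt_one (by norm_num) (by norm_num)).const_mul _
    rw [mul_zero] at this
    exact (this.eventually (gt_mem_nhds (by positivity))).exists
  have hS : CauchySeq fun m => semigroup C (T m - T n) (z n) := by
    have h1 : Tendsto (fun m => T m - T n) atTop (𝓝[Ici 0] ((⨆ i, T i) - T n)) := by
      refine tendsto_nhdsWithin_iff.2 ⟨hTlim.sub_const _, ?_⟩
      filter_upwards [eventually_ge_atTop n] with m hm
      exact sub_nonneg.2 (hTmono hm)
    exact ((hC.continuousOn_semigroup hdense (z n) _
      (sub_nonneg.2 (le_ciSup hTbdd n))).tendsto.comp h1).cauchySeq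
  have hclose : ∀ m, n ≤ m → ‖z m - semigroup C (T m - T n) (z n)‖ < ε / 3 := by
    intro m hm
    obtain ⟨k, rfl⟩ := Nat.exists_eq_add_of_le hm
    refine lt_of_le_of_lt ((hzdiff n k).trans ?_) hn
    have h2 : (0 : ℝ) < (1 / 2) ^ (n + k) := by positivity
    nlinarith
  obtain ⟨N, hN⟩ := Metric.cauchySeq_iff.1 hS (ε / 3) (by positivity)
  refine ⟨max n N, fun m hm => ?_⟩
  have h1 := hclose m ((le_max_left _ _).trans hm)
  have h2 := hclose (max n N) (le_max_left _ _)
  have h3 := hN m ((le_max_right _ _).trans hm) (max n N) (le_max_right _ _)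
  rw [dist_eq_norm] at h3 ⊢
  rw [norm_sub_rev] at h2
  set p := semigroup C (T m - T n) (z n)
  set q := semigroup C (T (max n N) - T n) (z n)
  have h4 := norm_sub_le_norm_sub_add_norm_sub (z m) p (z (max n N))
  have h5 := norm_sub_le_norm_sub_add_norm_sub p q (z (max n N))
  linarith

end IsMDissipative

end Tataru

/-! ### Ekeland's principle for a nonsymmetric distance. -/

section Ekeland

/-- Ekeland's variational principle for an upper semicontinuous function that is bounded above,
with respect to a nonnegative function `D` that satisfies the triangle inequality and a
completeness condition. -/
theorem exists_ekeland_max {X : Type*} [TopologicalSpace X] {D : X → X → ℝ} {Φ : X → ℝ}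
    (hD : ∀ x y, 0 ≤ D x y) (hself : ∀ x, D x x = 0)
    (htri : ∀ x y z, D x z ≤ D x y + D y z) (hcont : ∀ y, Continuous fun x => D x y)
    (hcomplete : ∀ (z : ℕ → X) (c : ℝ), (∀ n, D (z (n + 1)) (z n) ≤ c * (1 / 2) ^ n) →
      ∃ a, Tendsto z atTop (𝓝 a))
    (hΦ : UpperSemicontinuous Φ) {M : ℝ} (hM : ∀ x, Φ x ≤ M) {ρ : ℝ} (hρ : 0 < ρ) (z₀ : X) :
    ∃ z, Φ z₀ ≤ Φ z ∧ ∀ w, Φ w - ρ * D w z ≤ Φ z := by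
  set S : X → Set X := fun z => {w | Φ z ≤ Φ w - ρ * D w z} with hS
  have hSself : ∀ z, z ∈ S z := fun z => by simp [hS, hself]
  have hStrans : ∀ z w v, w ∈ S z → v ∈ S w → v ∈ S z := by
    intro z w v hw hv
    simp only [hS, mem_ofPred_eq] at *
    nlinarith [htri v w z]
  have hSclosed : ∀ z, IsClosed (S z) := by
    intro z
    have h1 : UpperSemicontinuous fun w => Φ w + -(ρ * D w z) :=
      hΦ.add ((continuous_const.mul (hcont z)).neg).upperSemicontinuous
    simpa [hS, sub_eq_add_neg, preimage, Ici] using h1.isClosed_preimage (Φ z)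
  have hbdd : ∀ z, BddAbove (Φ '' S z) := fun z => ⟨M, by rintro _ ⟨w, _, rfl⟩; exact hM w⟩
  -- The relation `w ∈ S z` is a preorder with closed upper sets; one climbs by choosing near
  -- maximizers of `Φ` in successive sets.
  have hstep : ∀ (n : ℕ) (z : X), ∃ w ∈ S z, ∀ v ∈ S z, Φ v ≤ Φ w + (1 / 2) ^ n := by
    intro n z
    obtain ⟨_, ⟨w, hw, rfl⟩, h⟩ := exists_lt_of_lt_csSup ⟨_, mem_image_of_mem Φ (hSself z)⟩
      (sub_lt_self (sSup (Φ '' S z)) (show (0 : ℝ) < (1 / 2) ^ n by positivity))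
    exact ⟨w, hw, fun v hv => by
      have := le_csSup (hbdd z) (mem_image_of_mem Φ hv)
      linarith⟩
  choose next hnext hnext' using hstep
  let z : ℕ → X := fun n => Nat.rec z₀ (fun n w => next n w) n
  have hz0 : z 0 = z₀ := rfl
  have hzs : ∀ n, z (n + 1) = next n (z n) := fun n => rfl
  have hzmem : ∀ n k, z (n + k) ∈ S (z n) := by
    intro n k
    induction k with
    | zero => exact hSself _
    | succ k ih => exact hStrans _ _ _ ih (by rw [← add_assoc, hzs]; exact hnext _ _)
  have hub : ∀ n, ∀ v ∈ S (z n), Φ v ≤ Φ (z (n + 1)) + (1 / 2) ^ n := fun n v hv => by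
    rw [hzs]; exact hnext' n (z n) v hv
  -- The sequence is shifted by one because `z₀` is arbitrary: only from `z 1` on is the possible
  -- further gain of `Φ`, hence the next step, geometrically small.
  obtain ⟨a, ha⟩ := hcomplete (fun n => z (n + 1)) (1 / ρ) fun n => by
    have h1 : z (n + 2) ∈ S (z (n + 1)) := hzmem (n + 1) 1
    have h2 := hub n _ (hzmem n 2)
    simp only [hS, mem_ofPred_eq] at h1
    rw [one_div_mul_eq_div, le_div_iff₀ hρ]
    show D (z (n + 2)) (z (n + 1)) * ρ ≤ _
    linarith
  have haS : ∀ n, a ∈ S (z n) := fun n => (hSclosed (z n)).mem_of_tendsto ha (by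
    filter_upwards [eventually_ge_atTop n] with m hm
    obtain ⟨k, rfl⟩ := Nat.exists_eq_add_of_le hm
    rw [add_assoc]
    exact hzmem n (k + 1))
  have hle : ∀ n, Φ (z n) ≤ Φ a := fun n => by
    have h1 := haS n
    simp only [hS, mem_ofPred_eq] at h1
    have := mul_nonneg hρ.le (hD a (z n))
    linarith
  refine ⟨a, hz0 ▸ hle 0, fun w => ?_⟩
  by_contra! hw
  have hwS : w ∈ S a := hw.le
  -- A violating `w` would lie in every `S (z n)`, leaving no room for `Φ w > Φ a`.
  have h1 : ∀ n : ℕ, Φ w - Φ a ≤ (1 / 2 : ℝ) ^ n := fun n => by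
    have := hub n w (hStrans _ _ _ (haS n) hwS)
    have := hle (n + 1)
    linarith
  have h2 : Φ w - Φ a ≤ 0 := ge_of_tendsto'
    (tendsto_pow_atTop_nhds_zero_of_lt_one (by norm_num : (0 : ℝ) ≤ 1 / 2) (by norm_num)) h1
  have := mul_nonneg hρ.le (hD w a)
  linarith

end Ekeland

/-! ### Choice of the penalty parameters. -/

section Penalization

/-- For large `μ` the near maximizers of `A - μ b` make the penalty `μ b` small. -/
theorem exists_penalty_le {Z : Type*} [Nonempty Z] {A b : Z → ℝ} {M : ℝ} (hA : ∀ z, |A z| ≤ M)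
    (hb : ∀ z, 0 ≤ b z) {w₀ : Z} (hw₀ : b w₀ = 0) {δ : ℝ} (hδ : 0 < δ) :
    ∃ μ : ℝ, 1 ≤ μ ∧
      ∀ z, (∀ w, A w - μ * b w ≤ A z - μ * b z + δ) → μ * b z ≤ 4 * δ := by
  set g : ℕ → ℝ := fun n => ⨆ z, A z - 2 ^ n * b z with hg
  have hbdd : ∀ n : ℕ, BddAbove (range fun z => A z - 2 ^ n * b z) := fun n => by
    refine ⟨M, ?_⟩
    rintro _ ⟨z, rfl⟩
    have h1 := (abs_le.1 (hA z)).2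
    have h2 : 0 ≤ 2 ^ n * b z := mul_nonneg (by positivity) (hb z)
    simp only
    linarith
  have hanti : Antitone g := fun m n hmn => ciSup_mono (hbdd m) fun z => by
    have h1 : (2 : ℝ) ^ m ≤ 2 ^ n := pow_le_pow_right₀ (by norm_num) hmn
    have := mul_le_mul_of_nonneg_right h1 (hb z)
    linarith
  have hlow : BddBelow (range g) := by
    refine ⟨-M, ?_⟩
    rintro _ ⟨n, rfl⟩
    have h1 := le_ciSup (hbdd n) w₀
    simp only [hw₀, mul_zero, sub_zero] at h1
    exact (abs_le.1 (hA w₀)).1.trans h1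
  have hlim := tendsto_atTop_ciInf hanti hlow
  have hdiff := hlim.sub (hlim.comp (tendsto_add_atTop_nat 1))
  rw [sub_self] at hdiff
  obtain ⟨n, hn⟩ := (hdiff.eventually (gt_mem_nhds hδ)).exists
  simp only [Function.comp_apply] at hn
  -- The suprema `g n` decrease to a limit, so some drop `g n - g (n + 1)` is below `δ`. Half of the
  -- penalty at level n + 1 is bounded by that drop plus `δ`.
  refine ⟨2 ^ (n + 1), one_le_pow₀ (by norm_num), fun z hz => ?_⟩
  have h1 : g (n + 1) ≤ A z - 2 ^ (n + 1) * b z + δ := ciSup_le hz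
  have h2 : A z - 2 ^ n * b z ≤ g n := le_ciSup (hbdd n) z
  rw [pow_succ] at h1 ⊢
  linarith

variable {E : Type*} [NormedAddCommGroup E] [InnerProductSpace ℝ E]

/-- Completing the square in `ξ`: the optimal `ξ` is the midpoint of `x` and `y` shrunk by the
factor μ/(μ + κ). -/
theorem penalty_eq {μ κ : ℝ} (hμ : 0 < μ) (hκ : 0 < κ) (x y ξ : E) :
    μ / 2 * ‖x - ξ‖ ^ 2 + μ / 2 * ‖y - ξ‖ ^ 2 + κ * ‖ξ‖ ^ 2 =
      μ * (‖x - y‖ ^ 2 / 4) + κ * (μ / (μ + κ)) * ‖(1 / 2 : ℝ) • (x + y)‖ ^ 2 +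
        (μ + κ) * ‖ξ - (μ / (μ + κ)) • (1 / 2 : ℝ) • (x + y)‖ ^ 2 := by
  have h : μ + κ ≠ 0 := by positivity
  simp only [norm_sub_sq_real, norm_smul, inner_smul_right, mul_pow, Real.norm_eq_abs, sq_abs,
    norm_add_sq_real, inner_add_right, real_inner_comm ξ x, real_inner_comm ξ y]
  field_simp
  ring

-- The estimates hold for every triple that does at least as well as a fixed near-optimal one, so
-- they survive the later Ekeland step, and `R`, `R'` are known before `ρ` is chosen. After
-- minimizing over `ξ`, a large `μ` controls ‖x - y‖ and a small `κ` confines the midpoint; density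
-- of the domain supplies a nearly optimal `ξ₁`, whose `R` comes from any element of `C ξ₁`.
set_option maxHeartbeats 1000000 in
theorem IsMDissipative.exists_penalization {C : Set (E × E)} (hC : IsMDissipative C)
    (hdense : Dense (domain C)) {u v : E → ℝ} {M : ℝ} (hu : ∀ x, |u x| ≤ M) (hv : ∀ x, |v x| ≤ M)
    {δ : ℝ} (hδ : 0 < δ) (hδ1 : δ ≤ 1) :
    ∃ μ κ R R' : ℝ, 0 < μ ∧ 0 < κ ∧ 0 ≤ R ∧ 0 ≤ R' ∧ ∃ x₁ y₁ ξ₁ : E, ξ₁ ∈ sublevel C R ∧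
      ∀ x y ξ : E,
        u x₁ - v y₁ - (μ / 2 * ‖x₁ - ξ₁‖ ^ 2 + μ / 2 * ‖y₁ - ξ₁‖ ^ 2 + κ * ‖ξ₁‖ ^ 2) ≤
          u x - v y - (μ / 2 * ‖x - ξ‖ ^ 2 + μ / 2 * ‖y - ξ‖ ^ 2 + κ * ‖ξ‖ ^ 2) →
        μ * ‖x - y‖ ^ 2 ≤ δ ∧ ‖x - y‖ ≤ δ ∧ (1 + ‖y‖) * ‖μ • (x + y - (2 : ℝ) • ξ)‖ ≤ δ ∧
          ‖x‖ ≤ R' ∧ ‖y‖ ≤ R' ∧ ∀ w, u w - v w - δ ≤ u x - v y := by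
  set d : ℝ := δ ^ 2 / 64 with hd
  have hdpos : 0 < d := by positivity
  obtain ⟨μ, hμ1, hμ⟩ := exists_penalty_le (Z := E × E) (A := fun z => u z.1 - v z.2)
    (b := fun z => ‖z.1 - z.2‖ ^ 2 / 4) (M := M + M) (w₀ := (0, 0)) (δ := 4 * d)
    (fun z => (abs_sub _ _).trans (add_le_add (hu _) (hv _))) (fun z => by positivity) (by simp)
    (by positivity)
  have hμ0 : 0 < μ := by linarith
  set A : E × E → ℝ := fun z => u z.1 - v z.2 - μ * (‖z.1 - z.2‖ ^ 2 / 4) with hA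
  have hAle : ∀ z, A z ≤ M + M := fun z => by
    have h1 := (abs_le.1 (hu z.1)).2
    have h2 := (abs_le.1 (hv z.2)).1
    have h3 : 0 ≤ μ * (‖z.1 - z.2‖ ^ 2 / 4) := by positivity
    simp only [hA]
    linarith
  have near : ∀ (A : E × E → ℝ), (∀ z, A z ≤ M + M) → ∀ ε : ℝ, 0 < ε →
      ∃ z, ∀ w, A w ≤ A z + ε := by
    intro A hA ε hε
    have hb : BddAbove (range A) := ⟨M + M, by rintro _ ⟨z, rfl⟩; exact hA z⟩
    obtain ⟨z, hz⟩ := exists_lt_of_lt_ciSup (sub_lt_self (⨆ z, A z) hε)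
    exact ⟨z, fun w => by linarith [le_ciSup hb w]⟩
  obtain ⟨z₀, hz₀⟩ := near A hAle d hdpos
  set m : E × E → E := fun z => (1 / 2 : ℝ) • (z.1 + z.2) with hm
  -- Small enough that confining the midpoint costs at most `d` at the near maximizer `z₀`.
  set κ : ℝ := d / (1 + ‖m z₀‖ ^ 2) with hκ
  have hκ0 : 0 < κ := by positivity
  have hκd : κ * (1 + ‖m z₀‖ ^ 2) = d := by rw [hκ]; field_simp
  set θ : ℝ := μ / (μ + κ) with hθ
  have hθ0 : 0 < θ := by positivity
  have hθ1 : θ ≤ 1 := by rw [hθ, div_le_one (by positivity)]; linarith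
  have hθκ : μ * (1 - θ) = κ * θ := by rw [hθ]; field_simp; ring
  have hκθ : 0 < κ * θ := by positivity
  have hκθd : κ * θ ≤ d := (mul_le_of_le_one_right hκ0.le hθ1).trans (by
    have := mul_nonneg hκ0.le (sq_nonneg ‖m z₀‖)
    linarith only [this, hκd])
  set A' : E × E → ℝ := fun z => A z - κ * θ * ‖m z‖ ^ 2 with hA'
  have hA'A : ∀ z, A' z ≤ A z := fun z => by
    have : 0 ≤ κ * θ * ‖m z‖ ^ 2 := by positivity
    simp only [hA']
    linarith
  have hA'z₀ : A z₀ - d ≤ A' z₀ := by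
    simp only [hA']
    have := mul_le_mul_of_nonneg_right (mul_le_of_le_one_right hκ0.le hθ1) (sq_nonneg ‖m z₀‖)
    linarith only [this, hκd, hκ0]
  set R' : ℝ := 2 + 4 * d / (κ * θ) with hR'
  have hR'0 : 0 ≤ R' := by positivity
  -- The tolerated distance of `ξ` from its optimum; even after multiplication by 2μ(1 + ‖y‖) it
  -- contributes at most δ/2.
  set s : ℝ := δ / (4 * μ * (1 + R')) with hs
  have hs0 : 0 < s := by positivity
  set d₂ : ℝ := min (d / 2) (s ^ 2 / 2) with hd₂
  have hd₂0 : 0 < d₂ := by positivity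
  have hd₂d : d₂ ≤ d / 2 := min_le_left _ _
  have hd₂s : d₂ ≤ s ^ 2 / 2 := min_le_right _ _
  obtain ⟨z₁, hz₁⟩ := near A' (fun z => (hA'A z).trans (hAle z)) d₂ hd₂0
  obtain ⟨ξ₁, ⟨η₁, hξ₁⟩, hdist⟩ := Metric.mem_closure_iff.1 (hdense (θ • m z₁))
    (√(d₂ / (μ + κ))) (by positivity)
  rw [dist_eq_norm, norm_sub_rev] at hdist
  have hξ₁θ : (μ + κ) * ‖ξ₁ - θ • m z₁‖ ^ 2 ≤ d₂ := by
    have := pow_le_pow_left₀ (norm_nonneg _) hdist.le 2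
    rw [Real.sq_sqrt (by positivity), le_div_iff₀ (by positivity)] at this
    linarith
  clear_value d₂ s R' A' A m θ κ d
  refine ⟨μ, κ, ‖η₁‖, R', hμ0, hκ0, norm_nonneg _, hR'0, z₁.1, z₁.2, ξ₁,
    hC.mem_sublevel hξ₁, fun x y ξ hxy => ?_⟩
  rw [penalty_eq hμ0 hκ0, penalty_eq hμ0 hκ0, ← hθ] at hxy
  have hΦ : A' z₁ - d₂ ≤ A' (x, y) - (μ + κ) * ‖ξ - θ • m (x, y)‖ ^ 2 := by
    simp only [hA', hA, hm] at hξ₁θ ⊢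
    linarith
  have hξ0 : 0 ≤ (μ + κ) * ‖ξ - θ • m (x, y)‖ ^ 2 := by positivity
  have hξ : ‖ξ - θ • m (x, y)‖ ≤ s := by
    refine le_of_sq_le_sq ?_ hs0.le
    have h1 := hz₁ (x, y)
    have h2 := le_mul_of_one_le_left (sq_nonneg ‖ξ - θ • m (x, y)‖)
      (show 1 ≤ μ + κ by linarith only [hμ1, hκ0])
    linarith only [h1, h2, hΦ, hd₂s]
  have hAxy : ∀ w, A w ≤ A (x, y) - κ * θ * ‖m (x, y)‖ ^ 2 + 4 * d := fun w => by
    have h1 := hz₀ w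
    have h2 := hz₁ z₀
    have h3 : A' (x, y) = A (x, y) - κ * θ * ‖m (x, y)‖ ^ 2 := by rw [hA']
    linarith
  have hm0 : 0 ≤ κ * θ * ‖m (x, y)‖ ^ 2 := by positivity
  have hκm : κ * θ * ‖m (x, y)‖ ^ 2 ≤ 4 * d := by linarith [hAxy (x, y)]
  have hxy1 : μ * ‖x - y‖ ^ 2 ≤ δ ^ 2 := by
    have h1 := hμ (x, y) fun w => by
      have := hAxy w
      simp only [hA] at this ⊢
      linarith
    simp only at h1
    linarith
  have hxyδ : ‖x - y‖ ≤ δ := by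
    refine le_of_sq_le_sq ?_ hδ.le
    exact (le_mul_of_one_le_left (sq_nonneg _) hμ1).trans hxy1
  have hmle : ‖m (x, y)‖ ≤ 1 + 4 * d / (κ * θ) := by
    have h1 : ‖m (x, y)‖ ^ 2 ≤ 4 * d / (κ * θ) := by
      rw [le_div_iff₀ hκθ]; linarith
    have h2 := two_mul_le_add_sq ‖m (x, y)‖ 1
    have h3 := sq_nonneg ‖m (x, y)‖
    linarith only [h1, h2, h3]
  have hx : ‖x‖ ≤ ‖m (x, y)‖ + 1 := by
    have h1 : x = m (x, y) + (1 / 2 : ℝ) • (x - y) := by simp only [hm]; module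
    have h2 : ‖(1 / 2 : ℝ) • (x - y)‖ ≤ 1 := by
      rw [norm_smul]; norm_num; linarith
    calc ‖x‖ = ‖m (x, y) + (1 / 2 : ℝ) • (x - y)‖ := by rw [← h1]
      _ ≤ _ := (norm_add_le _ _).trans (by linarith)
  have hy : ‖y‖ ≤ ‖m (x, y)‖ + 1 := by
    have h1 : y = m (x, y) - (1 / 2 : ℝ) • (x - y) := by simp only [hm]; module
    have h2 : ‖(1 / 2 : ℝ) • (x - y)‖ ≤ 1 := by
      rw [norm_smul]; norm_num; linarith
    calc ‖y‖ = ‖m (x, y) - (1 / 2 : ℝ) • (x - y)‖ := by rw [← h1]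
      _ ≤ _ := (norm_sub_le _ _).trans (by linarith)
  have hδ2 : δ ^ 2 ≤ δ := pow_le_of_le_one hδ.le hδ1 two_ne_zero
  refine ⟨hxy1.trans hδ2, hxyδ, ?_, by linarith, by linarith, fun w => ?_⟩
  -- The mismatch of the momenta splits into the shrinkage of the midpoint, controlled by κθ‖m‖² and
  -- κθ, and the deviation of `ξ` from its optimum, controlled by `s`.
  · have h1 : μ • (x + y - (2 : ℝ) • ξ) =
        (2 * (κ * θ)) • m (x, y) - (2 * μ) • (ξ - θ • m (x, y)) := by
      rw [← hθκ]
      simp only [hm]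
      module
    have h2 : ‖μ • (x + y - (2 : ℝ) • ξ)‖ ≤ 2 * (κ * θ) * ‖m (x, y)‖ + 2 * μ * s := by
      rw [h1]
      refine (norm_sub_le _ _).trans (add_le_add ?_ ?_)
      · rw [norm_smul, Real.norm_of_nonneg (by positivity)]
      · rw [norm_smul, Real.norm_of_nonneg (by positivity)]
        gcongr
    have h3 : (1 + R') * (2 * μ * s) = δ / 2 := by rw [hs]; field_simp; norm_num
    have h4 : (2 + ‖m (x, y)‖) * (2 * (κ * θ) * ‖m (x, y)‖) ≤ δ / 2 := by
      have h5 : (2 + ‖m (x, y)‖) * (2 * (κ * θ) * ‖m (x, y)‖) ≤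
          2 * (κ * θ) + 4 * (κ * θ * ‖m (x, y)‖ ^ 2) := by
        have := mul_nonneg hκθ.le (sq_nonneg (‖m (x, y)‖ - 1))
        linarith only [this]
      linarith only [h5, hκm, hκθd, hd, hδ2, hδ]
    calc (1 + ‖y‖) * ‖μ • (x + y - (2 : ℝ) • ξ)‖
        ≤ (1 + ‖y‖) * (2 * (κ * θ) * ‖m (x, y)‖ + 2 * μ * s) := by gcongr
      _ = (1 + ‖y‖) * (2 * (κ * θ) * ‖m (x, y)‖) + (1 + ‖y‖) * (2 * μ * s) := by ring
      _ ≤ (2 + ‖m (x, y)‖) * (2 * (κ * θ) * ‖m (x, y)‖) + (1 + R') * (2 * μ * s) := by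
        refine add_le_add (mul_le_mul_of_nonneg_right ?_ (by positivity))
          (mul_le_mul_of_nonneg_right ?_ (by positivity)) <;> linarith only [hy, hmle, hR']
      _ ≤ δ := by linarith
  · have h1 := hAxy (w, w)
    have h2 : 0 ≤ μ * (‖x - y‖ ^ 2 / 4) := by positivity
    simp only [hA, sub_self, norm_zero] at h1
    linarith only [h1, h2, hm0, hd, hδ2, hδ]

end Penalization

/-! ### Sub- and supersolution inequalities at perturbed maxima. -/

section TestFunctions

/-- A continuous majorant removes the envelope, so no regularity of the supremum over `q` in the
Hamiltonian is needed. -/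
theorem upperEnvelope_le {X : Type*} [TopologicalSpace X] {g k : X → ℝ} (hgk : ∀ x, g x ≤ k x)
    {x : X} (hk : ContinuousAt k x) : upperEnvelope g x ≤ (k x : EReal) := by
  have h1 : Tendsto (fun y => (k y : EReal)) (𝓝 x) (𝓝 (k x : EReal)) :=
    (continuous_coe_real_ereal.tendsto _).comp hk
  rw [← h1.limsup_eq]
  exact limsup_le_limsup (Eventually.of_forall fun y => EReal.coe_le_coe_iff.2 (hgk y))

theorem le_lowerEnvelope {X : Type*} [TopologicalSpace X] {g k : X → ℝ} (hgk : ∀ x, k x ≤ g x)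
    {x : X} (hk : ContinuousAt k x) : (k x : EReal) ≤ lowerEnvelope g x := by
  have h1 : Tendsto (fun y => (k y : EReal)) (𝓝 x) (𝓝 (k x : EReal)) :=
    (continuous_coe_real_ereal.tendsto _).comp hk
  rw [← h1.liminf_eq]
  exact liminf_le_liminf (Eventually.of_forall fun y => EReal.coe_le_coe_iff.2 (hgk y))

variable {E U : Type*} [NormedAddCommGroup E] [InnerProductSpace ℝ E] [CompleteSpace E]
  [NormedAddCommGroup U] [InnerProductSpace ℝ U] [CompleteSpace U]

theorem norm_adjoint_apply_le (A : U →L[ℝ] E) (p : E) :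
    ‖ContinuousLinearMap.adjoint A p‖ ≤ ‖A‖ * ‖p‖ := by
  simpa using (ContinuousLinearMap.adjoint A).le_opNorm p

theorem hamiltonian_add_le (F : E → E) (B : E → U →L[ℝ] E) (x p : E) {q : E} {ρ : ℝ}
    (hq : ‖q‖ ≤ ρ) :
    hamiltonian F B x (p + q) ≤ inner ℝ (F x) p + ρ * ‖F x‖ +
      1 / 2 * (‖ContinuousLinearMap.adjoint (B x) p‖ + ρ * ‖B x‖) ^ 2 := by
  have h1 : inner ℝ (F x) q ≤ ρ * ‖F x‖ := (real_inner_le_norm _ _).trans (by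
    rw [mul_comm]; gcongr)
  have h2 : ‖ContinuousLinearMap.adjoint (B x) q‖ ≤ ρ * ‖B x‖ :=
    (norm_adjoint_apply_le _ _).trans (by rw [mul_comm]; gcongr)
  have h3 : ‖ContinuousLinearMap.adjoint (B x) (p + q)‖ ≤
      ‖ContinuousLinearMap.adjoint (B x) p‖ + ρ * ‖B x‖ := by
    rw [map_add]
    exact (norm_add_le _ _).trans (by linarith)
  have h4 := pow_le_pow_left₀ (norm_nonneg _) h3 2
  rw [hamiltonian, inner_add_right]
  linarith

theorem le_hamiltonian_add (F : E → E) (B : E → U →L[ℝ] E) (x p : E) {q : E} {ρ : ℝ}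
    (hq : ‖q‖ ≤ ρ) :
    inner ℝ (F x) p - ρ * ‖F x‖ +
      1 / 2 * (max (‖ContinuousLinearMap.adjoint (B x) p‖ - ρ * ‖B x‖) 0) ^ 2 ≤
      hamiltonian F B x (p + q) := by
  have h1 : -(ρ * ‖F x‖) ≤ inner ℝ (F x) q := by
    refine neg_le_of_abs_le ((abs_real_inner_le_norm _ _).trans ?_)
    rw [mul_comm]; gcongr
  have h2 : ‖ContinuousLinearMap.adjoint (B x) q‖ ≤ ρ * ‖B x‖ :=
    (norm_adjoint_apply_le _ _).trans (by rw [mul_comm]; gcongr)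
  have h3 : max (‖ContinuousLinearMap.adjoint (B x) p‖ - ρ * ‖B x‖) 0 ≤
      ‖ContinuousLinearMap.adjoint (B x) (p + q)‖ := by
    refine max_le ?_ (norm_nonneg _)
    have := norm_sub_le (ContinuousLinearMap.adjoint (B x) (p + q))
      (ContinuousLinearMap.adjoint (B x) q)
    rw [map_add, add_sub_cancel_right] at this
    rw [map_add]
    linarith
  have h4 := pow_le_pow_left₀ (le_max_right _ _) h3 2
  rw [hamiltonian, inner_add_right]
  linarith

variable {C : Set (E × E)} {F : E → E} {B : E → U →L[ℝ] E} {α : ℝ} {h f : E → ℝ}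

theorem IsSubsolution.le_of_max_tataruDist (hf : IsSubsolution (opHat₀ C F B) α h f)
    (hF : Continuous F) (hB : Continuous B) {μ ρ : ℝ} (hμ : 0 < μ) (hρ : 0 < ρ) {ξ η : E}
    (hξ : (ξ, η) ∈ canonicalRestriction C) {x₀ : E}
    (hmax : ∀ x, f x - (μ / 2 * ‖x - ξ‖ ^ 2 + ρ * tataruDist C x x₀) ≤
      f x₀ - μ / 2 * ‖x₀ - ξ‖ ^ 2) :
    α⁻¹ * (f x₀ - h x₀) ≤ μ * inner ℝ (x₀ - ξ) η + ρ + (inner ℝ (F x₀) (μ • (x₀ - ξ)) +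
      ρ * ‖F x₀‖ +
      1 / 2 * (‖ContinuousLinearMap.adjoint (B x₀) (μ • (x₀ - ξ))‖ + ρ * ‖B x₀‖) ^ 2) := by
  have hd : 0 ≤ ρ * tataruDist C x₀ x₀ := mul_nonneg hρ.le (tataruDist_nonneg _ _)
  -- The Tataru distance is based at the maximum point itself, where it vanishes.
  have h1 := hf.le_of_max (_, _) ⟨μ, ρ, ξ, η, x₀, hμ, hρ, hξ, rfl, rfl⟩ x₀ fun x => by
    have h2 := hmax x
    simp only [tataruDist_self]
    linarith
  have hBadj : Continuous fun x => ContinuousLinearMap.adjoint (B x) :=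
    ContinuousLinearMap.adjoint.continuous.comp hB
  refine EReal.coe_le_coe_iff.1 (h1.trans (upperEnvelope_le (k := fun x =>
    μ * inner ℝ (x - ξ) η + ρ + (inner ℝ (F x) (μ • (x - ξ)) + ρ * ‖F x‖ +
      1 / 2 * (‖ContinuousLinearMap.adjoint (B x) (μ • (x - ξ))‖ + ρ * ‖B x‖) ^ 2)) (fun x => ?_)
    (Continuous.continuousAt (by fun_prop))))
  have : Nonempty (Metric.closedBall (0 : E) ρ) := ⟨⟨0, Metric.mem_closedBall_self hρ.le⟩⟩
  exact add_le_add_right (ciSup_le fun q =>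
    hamiltonian_add_le F B x _ (mem_closedBall_zero_iff.1 q.2)) _

theorem IsSupersolution.ge_of_max_tataruDist (hf : IsSupersolution (opHat₁ C F B) α h f)
    (hF : Continuous F) (hB : Continuous B) {μ ρ : ℝ} (hμ : 0 < μ) (hρ : 0 < ρ) {ξ η : E}
    (hξ : (ξ, η) ∈ canonicalRestriction C) {x₀ : E}
    (hmax : ∀ x, -f x - (μ / 2 * ‖x - ξ‖ ^ 2 + ρ * tataruDist C x x₀) ≤
      -f x₀ - μ / 2 * ‖x₀ - ξ‖ ^ 2) :
    -(μ * inner ℝ (x₀ - ξ) η) - ρ + (inner ℝ (F x₀) (-(μ • (x₀ - ξ))) - ρ * ‖F x₀‖ +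
      1 / 2 * (max (‖ContinuousLinearMap.adjoint (B x₀) (-(μ • (x₀ - ξ)))‖ - ρ * ‖B x₀‖) 0) ^ 2) ≤
      α⁻¹ * (f x₀ - h x₀) := by
  have h1 := hf.ge_of_max (_, _) ⟨μ, ρ, ξ, η, x₀, hμ, hρ, hξ, rfl, rfl⟩ x₀ fun x => by
    have h2 := hmax x
    simp only [tataruDist_self]
    linarith
  have hBadj : Continuous fun x => ContinuousLinearMap.adjoint (B x) :=
    ContinuousLinearMap.adjoint.continuous.comp hB
  refine EReal.coe_le_coe_iff.1 ((le_lowerEnvelope (k := fun x =>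
    -(μ * inner ℝ (x - ξ) η) - ρ + (inner ℝ (F x) (-(μ • (x - ξ))) - ρ * ‖F x‖ +
      1 / 2 * (max (‖ContinuousLinearMap.adjoint (B x) (-(μ • (x - ξ)))‖ - ρ * ‖B x‖) 0) ^ 2))
    (fun x => ?_) (Continuous.continuousAt (by fun_prop))).trans h1)
  have : Nonempty (Metric.closedBall (0 : E) ρ) := ⟨⟨0, Metric.mem_closedBall_self hρ.le⟩⟩
  exact add_le_add_right (le_ciInf fun q =>
    le_hamiltonian_add F B x _ (mem_closedBall_zero_iff.1 q.2)) _

end TestFunctions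

/-! ### Doubling of variables. -/

section Comparison

/-- Young's inequality with weights θ and 1 - θ. The error involves only `r`, whatever the size of
`b`; this is what `θ < 1` buys. -/
theorem half_sq_le_of_le_add {a b r θ : ℝ} (ha : 0 ≤ a) (h : a ≤ b + r) (hθ : 0 < θ)
    (hθ1 : θ < 1) : 1 / 2 * a ^ 2 ≤ b ^ 2 / (2 * θ) + r ^ 2 / (2 * (1 - θ)) := by
  have h1 : 0 < 1 - θ := sub_pos.2 hθ1
  have h2 : b ^ 2 / (2 * θ) + r ^ 2 / (2 * (1 - θ)) - 1 / 2 * (b + r) ^ 2 =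
      ((1 - θ) * b - θ * r) ^ 2 / (2 * θ * (1 - θ)) := by
    field_simp
    ring
  have h3 : 0 ≤ ((1 - θ) * b - θ * r) ^ 2 / (2 * θ * (1 - θ)) := by positivity
  have h4 := pow_le_pow_left₀ ha h 2
  linarith

variable {E U : Type*} [NormedAddCommGroup E] [InnerProductSpace ℝ E]

/-- First order condition in the variable `ξ`: moving `ξ` along the resolvent does not increase
`κ ‖ξ‖²`, so a near maximizer `ξ` satisfies a one-sided bound. -/
theorem IsMDissipative.inner_le_of_near_max {C : Set (E × E)} (hC : IsMDissipative C)
    (hzero : ((0 : E), (0 : E)) ∈ C) {μ κ ρ R : ℝ} (hμ : 0 ≤ μ) (hκ : 0 ≤ κ) (hρ : 0 ≤ ρ)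
    {x y ξ η : E}
    (hξ : ξ ∈ sublevel C R)
    (hη : Tendsto (fun n : ℕ => yosida C (1 / ((n : ℝ) + 1)) ξ) atTop (𝓝 η))
    (hmin : ∀ ζ ∈ sublevel C R, μ / 2 * ‖x - ξ‖ ^ 2 + μ / 2 * ‖y - ξ‖ ^ 2 + κ * ‖ξ‖ ^ 2 ≤
      μ / 2 * ‖x - ζ‖ ^ 2 + μ / 2 * ‖y - ζ‖ ^ 2 + κ * ‖ζ‖ ^ 2 + ρ * ‖ζ - ξ‖) :
    μ * inner ℝ (x - ξ) η + μ * inner ℝ (y - ξ) η ≤ ρ * R := by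
  have hstep : ∀ t : ℝ, 0 < t → μ * inner ℝ (x - ξ) (yosida C t ξ) +
      μ * inner ℝ (y - ξ) (yosida C t ξ) ≤ ρ * R + t * (μ * R ^ 2) := by
    intro t ht
    have h1 := hmin _ (hC.resolvent_mem_sublevel hξ ht)
    have h2 : ‖resolvent C t ξ‖ ≤ ‖ξ‖ := by
      simpa [hC.resolvent_apply_zero hzero ht] using hC.norm_resolvent_sub_le ht.le ξ 0
    have h3 : κ * ‖resolvent C t ξ‖ ^ 2 ≤ κ * ‖ξ‖ ^ 2 := by gcongr
    have h4 := hξ t ht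
    set c := yosida C t ξ
    have h5 : μ * ‖c‖ ^ 2 ≤ μ * R ^ 2 := by gcongr
    have h6 : ρ * ‖c‖ ≤ ρ * R := by gcongr
    have e : ∀ z : E, ‖z - resolvent C t ξ‖ ^ 2 =
        ‖z - ξ‖ ^ 2 - 2 * (t * inner ℝ (z - ξ) c) + t ^ 2 * ‖c‖ ^ 2 := fun z => by
      rw [resolvent_add_yosida ht, ← sub_sub, norm_sub_sq_real (z - ξ), inner_smul_right,
        norm_smul, mul_pow, Real.norm_eq_abs, sq_abs]
    rw [e, e] at h1
    have e2 : ‖resolvent C t ξ - ξ‖ = t * ‖c‖ := by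
      rw [resolvent_add_yosida ht, add_sub_cancel_left, norm_smul, Real.norm_of_nonneg ht.le]
    rw [e2] at h1
    have h7 : t * (μ * inner ℝ (x - ξ) c + μ * inner ℝ (y - ξ) c) ≤
        t * (ρ * ‖c‖ + t * (μ * ‖c‖ ^ 2)) := by
      linarith only [h1, h3]
    have h8 := le_of_mul_le_mul_left h7 ht
    have h9 := mul_le_mul_of_nonneg_left h5 ht.le
    linarith only [h8, h9, h6]
  have hl : Tendsto (fun n : ℕ => ρ * R + 1 / ((n : ℝ) + 1) * (μ * R ^ 2)) atTop
      (𝓝 (ρ * R + 0 * (μ * R ^ 2))) :=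
    (tendsto_one_div_add_atTop_nhds_zero_nat.mul_const _).const_add _
  rw [zero_mul, add_zero] at hl
  exact le_of_tendsto_of_tendsto' (((tendsto_const_nhds.inner hη).const_mul μ).add
    ((tendsto_const_nhds.inner hη).const_mul μ)) hl fun n => hstep _ Nat.one_div_pos_of_nat

variable [CompleteSpace E]

/-- The variational principle applied to the penalized doubling of variables. -/
theorem IsMDissipative.exists_doubling_max {C : Set (E × E)} (hC : IsMDissipative C)
    (hdense : Dense (domain C)) {u v : E → ℝ} (hu : UpperSemicontinuous u)
    (hv : LowerSemicontinuous v) {M : ℝ} (huM : ∀ x, |u x| ≤ M) (hvM : ∀ x, |v x| ≤ M)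
    {μ κ ρ R : ℝ} (hμ : 0 < μ) (hκ : 0 < κ) (hρ : 0 < ρ) (x₁ y₁ : E) {ξ₁ : E}
    (hξ₁ : ξ₁ ∈ sublevel C R) :
    ∃ x y, ∃ ξ ∈ sublevel C R,
      u x₁ - v y₁ - (μ / 2 * ‖x₁ - ξ₁‖ ^ 2 + μ / 2 * ‖y₁ - ξ₁‖ ^ 2 + κ * ‖ξ₁‖ ^ 2) ≤
        u x - v y - (μ / 2 * ‖x - ξ‖ ^ 2 + μ / 2 * ‖y - ξ‖ ^ 2 + κ * ‖ξ‖ ^ 2) ∧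
      ∀ x' y', ∀ ξ' ∈ sublevel C R,
        u x' - v y' - (μ / 2 * ‖x' - ξ'‖ ^ 2 + μ / 2 * ‖y' - ξ'‖ ^ 2 + κ * ‖ξ'‖ ^ 2) -
          ρ * (tataruDist C x' x + tataruDist C y' y + ‖ξ' - ξ‖) ≤
        u x - v y - (μ / 2 * ‖x - ξ‖ ^ 2 + μ / 2 * ‖y - ξ‖ ^ 2 + κ * ‖ξ‖ ^ 2) := by
  have : CompleteSpace (sublevel C R) := (hC.isClosed_sublevel R).completeSpace_coe
  set D : E × E × sublevel C R → E × E × sublevel C R → ℝ := fun z w =>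
    tataruDist C z.1 w.1 + tataruDist C z.2.1 w.2.1 + ‖(z.2.2 : E) - w.2.2‖ with hD
  set P : E × E × sublevel C R → ℝ := fun z => μ / 2 * ‖z.1 - z.2.2‖ ^ 2 +
    μ / 2 * ‖z.2.1 - z.2.2‖ ^ 2 + κ * ‖(z.2.2 : E)‖ ^ 2 with hP
  have hPcont : Continuous P := by fun_prop
  have hcomplete : ∀ (z : ℕ → E × E × sublevel C R) (c : ℝ),
      (∀ n, D (z (n + 1)) (z n) ≤ c * (1 / 2) ^ n) → ∃ a, Tendsto z atTop (𝓝 a) := by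
    intro z c hz
    simp only [hD] at hz
    obtain ⟨a, ha⟩ := hC.exists_tendsto_of_tataruDist_le hdense (z := fun n => (z n).1) (c := c)
      fun n => by
        refine le_trans ?_ (hz n)
        have := tataruDist_nonneg (C := C) (z (n + 1)).2.1 (z n).2.1
        have := norm_nonneg (((z (n + 1)).2.2 : E) - (z n).2.2)
        linarith
    obtain ⟨b, hb⟩ := hC.exists_tendsto_of_tataruDist_le hdense (z := fun n => (z n).2.1) (c := c)
      fun n => by
        refine le_trans ?_ (hz n)
        have := tataruDist_nonneg (C := C) (z (n + 1)).1 (z n).1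
        have := norm_nonneg (((z (n + 1)).2.2 : E) - (z n).2.2)
        linarith
    obtain ⟨ξ, hξ⟩ := cauchySeq_tendsto_of_complete
      (cauchySeq_of_le_geometric (f := fun n => (z n).2.2) (1 / 2) c (by norm_num) fun n => by
        refine le_trans ?_ (hz n)
        rw [dist_comm, Subtype.dist_eq, dist_eq_norm]
        have := tataruDist_nonneg (C := C) (z (n + 1)).1 (z n).1
        have := tataruDist_nonneg (C := C) (z (n + 1)).2.1 (z n).2.1
        linarith)
    exact ⟨(a, b, ξ), ha.prodMk_nhds (hb.prodMk_nhds hξ)⟩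
  have husc : UpperSemicontinuous fun z : E × E × sublevel C R =>
      u z.1 + -v z.2.1 + -P z := by
    refine UpperSemicontinuous.add (UpperSemicontinuous.add ?_ ?_) hPcont.neg.upperSemicontinuous
    · exact fun z r hr => (continuous_fst.tendsto z).eventually (hu z.1 r hr)
    · intro z r hr
      have h1 := hv z.2.1 (-r) (by linarith)
      have h2 := (continuous_fst.comp continuous_snd).tendsto z |>.eventually h1
      filter_upwards [h2] with w hw
      simp only [Function.comp_apply] at hw
      linarith
  obtain ⟨z, hz, hmax⟩ := exists_ekeland_max (D := D) (fun z w => by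
      have := tataruDist_nonneg (C := C) z.1 w.1
      have := tataruDist_nonneg (C := C) z.2.1 w.2.1
      positivity) (fun z => by simp [hD, tataruDist_self])
    (fun z w r => by
      have h1 := hC.tataruDist_triangle hdense z.1 w.1 r.1
      have h2 := hC.tataruDist_triangle hdense z.2.1 w.2.1 r.2.1
      have h3 := norm_sub_le_norm_sub_add_norm_sub (z.2.2 : E) w.2.2 r.2.2
      simp only [hD]
      linarith)
    (fun w => by
      have h1 := (continuous_tataruDist (C := C) w.1).comp
        (continuous_fst (X := E) (Y := E × sublevel C R))
      have h2 := (continuous_tataruDist (C := C) w.2.1).comp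
        ((continuous_fst (X := E) (Y := sublevel C R)).comp (continuous_snd (X := E)))
      exact (h1.add h2).add (by fun_prop)) hcomplete husc (M := M + M) (fun z => by
      have h1 := (abs_le.1 (huM z.1)).2
      have h2 := (abs_le.1 (hvM z.2.1)).1
      have h3 : 0 ≤ P z := by positivity
      linarith) hρ (x₁, y₁, ⟨ξ₁, hξ₁⟩)
  simp only [← sub_eq_add_neg] at hz hmax
  exact ⟨z.1, z.2.1, z.2.2, z.2.2.2, hz, fun x' y' ξ' hξ' => hmax (x', y', ⟨ξ', hξ'⟩)⟩

variable [NormedAddCommGroup U] [InnerProductSpace ℝ U] [CompleteSpace U]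

theorem norm_adjoint_apply_sub_le (A A' : U →L[ℝ] E) (p p' : E) :
    ‖ContinuousLinearMap.adjoint A p‖ ≤
      ‖ContinuousLinearMap.adjoint A' p'‖ + ‖A - A'‖ * ‖p‖ + ‖A'‖ * ‖p - p'‖ := by
  have h1 := norm_adjoint_apply_le (A - A') p
  have h2 := norm_adjoint_apply_le A' (p - p')
  have e : ContinuousLinearMap.adjoint A p = ContinuousLinearMap.adjoint A' p' +
      ContinuousLinearMap.adjoint (A - A') p + ContinuousLinearMap.adjoint A' (p - p') := by
    simp only [map_sub, sub_apply]
    abel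
  rw [e]
  exact (norm_add₃_le).trans (by linarith)

/-- The difference of the Hamiltonian terms of a subsolution at `x` and a supersolution at `y`,
for nearby points and momenta. -/
theorem hamiltonian_terms_le {F : E → E} {B : E → U →L[ℝ] E} {c : ℝ} (hc : 0 ≤ c)
    (hF : ∀ x y, ‖F x - F y‖ ≤ c * ‖x - y‖) (hB : ∀ x y, ‖B x - B y‖ ≤ c * ‖x - y‖)
    (hF' : ∀ x, ‖F x‖ ≤ c * (1 + ‖x‖)) (hB' : ∀ x, ‖B x‖ ≤ c * (1 + ‖x‖))
    {x y p p' : E} {ρ δ θ : ℝ} (hρ : 0 ≤ ρ) (hθ : 0 < θ) (hθ1 : θ < 1)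
    (hp : ‖x - y‖ * ‖p‖ ≤ δ)
    (hpp' : (1 + ‖y‖) * ‖p - p'‖ ≤ δ) (hρx : ρ * (c * (1 + ‖x‖)) ≤ δ)
    (hρy : ρ * (c * (1 + ‖y‖)) ≤ δ) :
    inner ℝ (F x) p + ρ * ‖F x‖ +
        1 / 2 * (‖ContinuousLinearMap.adjoint (B x) p‖ + ρ * ‖B x‖) ^ 2 -
      (inner ℝ (F y) p' - ρ * ‖F y‖ +
        (max (‖ContinuousLinearMap.adjoint (B y) p'‖ - ρ * ‖B y‖) 0) ^ 2 / (2 * θ)) ≤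
      2 * (c + 1) * δ + (2 * (c + 1) * δ) ^ 2 / (2 * (1 - θ)) := by
  have hρ' : ∀ {a b : ℝ}, a ≤ b → ρ * b ≤ δ → ρ * a ≤ δ := fun h h' =>
    (mul_le_mul_of_nonneg_left h hρ).trans h'
  have hFx := hρ' (hF' x) hρx
  have hFy := hρ' (hF' y) hρy
  have hBx := hρ' (hB' x) hρx
  have hBy := hρ' (hB' y) hρy
  have hcp : ∀ {a : ℝ}, a ≤ c * ‖x - y‖ → a * ‖p‖ ≤ c * δ := fun {a} h => by
    calc a * ‖p‖ ≤ c * ‖x - y‖ * ‖p‖ := by gcongr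
      _ = c * (‖x - y‖ * ‖p‖) := by ring
      _ ≤ c * δ := by gcongr
  have hcp' : ∀ {a : ℝ}, a ≤ c * (1 + ‖y‖) → a * ‖p - p'‖ ≤ c * δ := fun {a} h => by
    calc a * ‖p - p'‖ ≤ c * (1 + ‖y‖) * ‖p - p'‖ := by gcongr
      _ = c * ((1 + ‖y‖) * ‖p - p'‖) := by ring
      _ ≤ c * δ := by gcongr
  have h1 : inner ℝ (F x) p - inner ℝ (F y) p' ≤ c * δ + c * δ := by
    have e : inner ℝ (F x) p - inner ℝ (F y) p' =
        inner ℝ (F x - F y) p + inner ℝ (F y) (p - p') := by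
      rw [inner_sub_left, inner_sub_right]; ring
    rw [e]
    exact add_le_add ((real_inner_le_norm _ _).trans (hcp (hF x y)))
      ((real_inner_le_norm _ _).trans (hcp' (hF' y)))
  have h2 := norm_adjoint_apply_sub_le (B x) (B y) p p'
  have h3 := hcp (hB x y)
  have h4 := hcp' (hB' y)
  have h5 := le_max_left (‖ContinuousLinearMap.adjoint (B y) p'‖ - ρ * ‖B y‖) 0
  have h6 := half_sq_le_of_le_add (a := ‖ContinuousLinearMap.adjoint (B x) p‖ + ρ * ‖B x‖)
    (b := max (‖ContinuousLinearMap.adjoint (B y) p'‖ - ρ * ‖B y‖) 0) (r := 2 * (c + 1) * δ)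
    (by positivity) (by linarith) hθ hθ1
  linarith

/-- If the functions `f` and `f'` are a sub- and a supersolution, then a penalized maximum point of
`f x - θ f' y` satisfies the inequality that results from testing with the penalty. -/
theorem sub_le_of_doubling_max {C : Set (E × E)} {F : E → E} {B : E → U →L[ℝ] E}
    (hFc : Continuous F) (hBc : Continuous B) {c : ℝ} (hc : 0 ≤ c)
    (hF : ∀ x y, ‖F x - F y‖ ≤ c * ‖x - y‖) (hB : ∀ x y, ‖B x - B y‖ ≤ c * ‖x - y‖)
    (hF' : ∀ x, ‖F x‖ ≤ c * (1 + ‖x‖)) (hB' : ∀ x, ‖B x‖ ≤ c * (1 + ‖x‖))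
    {α : ℝ} {h f f' : E → ℝ} (hf : IsSubsolution (opHat₀ C F B) α h f)
    (hf' : IsSupersolution (opHat₁ C F B) α h f') {μ κ ρ R δ θ : ℝ} (hμ : 0 < μ) (hρ : 0 < ρ)
    (hδ1 : δ ≤ 1) (hθ : 0 < θ) (hθ1 : θ < 1) {x y ξ η : E}
    (hξ : ξ ∈ sublevel C R) (hη : (ξ, η) ∈ canonicalRestriction C)
    (hin : μ * inner ℝ (x - ξ) η + μ * inner ℝ (y - ξ) η ≤ ρ * R)
    (hmax : ∀ x' y', ∀ ξ' ∈ sublevel C R,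
      f x' - θ * f' y' - (μ / 2 * ‖x' - ξ'‖ ^ 2 + μ / 2 * ‖y' - ξ'‖ ^ 2 + κ * ‖ξ'‖ ^ 2) -
        ρ * (tataruDist C x' x + tataruDist C y' y + ‖ξ' - ξ‖) ≤
      f x - θ * f' y - (μ / 2 * ‖x - ξ‖ ^ 2 + μ / 2 * ‖y - ξ‖ ^ 2 + κ * ‖ξ‖ ^ 2))
    (hxy : μ * ‖x - y‖ ^ 2 ≤ δ) (hxy' : ‖x - y‖ ≤ δ)
    (he : (1 + ‖y‖) * ‖μ • (x + y - (2 : ℝ) • ξ)‖ ≤ δ)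
    (hρR : ρ * (R + 2) ≤ δ) (hρx : ρ * (c * (1 + ‖x‖)) ≤ δ) (hρy : ρ * (c * (1 + ‖y‖)) ≤ δ) :
    α⁻¹ * (f x - θ * f' y - (h x - θ * h y)) ≤
      δ + 2 * (c + 1) * δ + (2 * (c + 1) * δ) ^ 2 / (2 * (1 - θ)) := by
  have h1 := hf.le_of_max_tataruDist hFc hBc hμ hρ hη (x₀ := x) fun x' => by
    have := hmax x' y ξ hξ
    simp only [tataruDist_self, sub_self, norm_zero, add_zero] at this
    linarith
  -- The maximum concerns `θ f'`, so `f'` itself is tested with μ/θ and ρ/θ. Multiplying the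
  -- inequality by `θ` afterwards leaves the linear terms in place and gives the quadratic one the
  -- factor 1/(2θ).
  have h2 := hf'.ge_of_max_tataruDist hFc hBc (div_pos hμ hθ) (div_pos hρ hθ) hη (x₀ := y)
    fun y' => by
      have := hmax x y' ξ hξ
      simp only [tataruDist_self, sub_self, norm_zero, add_zero, zero_add] at this
      refine le_of_mul_le_mul_left ?_ hθ
      have e1 : ∀ a b, θ * (-f' a - (μ / θ / 2 * ‖a - ξ‖ ^ 2 + ρ / θ * b)) =
          -(θ * f' a) - (μ / 2 * ‖a - ξ‖ ^ 2 + ρ * b) := fun a b => by field_simp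
      have e2 := e1 y 0
      rw [mul_zero, add_zero, mul_zero, add_zero] at e2
      rw [e1, e2]
      linarith
  set p : E := μ • (x - ξ) with hp
  set p' : E := -(μ • (y - ξ)) with hp'
  have hpp : p - p' = μ • (x + y - (2 : ℝ) • ξ) := by rw [hp, hp']; module
  rw [← hpp] at he
  have hpn : ‖x - y‖ * ‖p‖ ≤ δ := by
    -- Up to half the mismatch, `p` is μ(x - y)/2, so ‖x - y‖ ‖p‖ is governed by μ‖x - y‖².
    have e : p = (μ / 2) • (x - y) + (1 / 2 : ℝ) • (p - p') := by
      rw [hp, hp']; module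
    have h3 : ‖p‖ ≤ μ / 2 * ‖x - y‖ + 1 / 2 * ‖p - p'‖ := by
      conv_lhs => rw [e]
      refine (norm_add_le _ _).trans_eq ?_
      rw [norm_smul, norm_smul, Real.norm_of_nonneg (by positivity),
        Real.norm_of_nonneg (by norm_num)]
    have h4 : ‖p - p'‖ ≤ δ := (le_mul_of_one_le_left (norm_nonneg _)
      (by linarith [norm_nonneg y])).trans he
    have h5 : ‖x - y‖ * ‖p - p'‖ ≤ 1 * δ := by
      gcongr
      exact hxy'.trans hδ1
    have h6 := mul_le_mul_of_nonneg_left h3 (norm_nonneg (x - y))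
    linarith
  have h3 := hamiltonian_terms_le hc hF hB hF' hB' hρ.le hθ hθ1 hpn he hρx hρy
  have h4 := mul_le_mul_of_nonneg_left h2 hθ.le
  have e1 : -((μ / θ) • (y - ξ)) = θ⁻¹ • p' := by
    rw [hp', smul_neg, smul_smul, inv_mul_eq_div]
  have e2 : max (‖ContinuousLinearMap.adjoint (B y) (θ⁻¹ • p')‖ - ρ / θ * ‖B y‖) 0 =
      θ⁻¹ * max (‖ContinuousLinearMap.adjoint (B y) p'‖ - ρ * ‖B y‖) 0 := by
    rw [map_smul, norm_smul, Real.norm_of_nonneg (by positivity),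
      mul_max_of_nonneg _ _ (by positivity), mul_zero, mul_sub, div_eq_inv_mul, mul_assoc]
  rw [e1, e2, inner_smul_right] at h4
  set m := max (‖ContinuousLinearMap.adjoint (B y) p'‖ - ρ * ‖B y‖) 0
  have e3 : θ * (-(μ / θ * inner ℝ (y - ξ) η) - ρ / θ + (θ⁻¹ * inner ℝ (F y) p' -
      ρ / θ * ‖F y‖ + 1 / 2 * (θ⁻¹ * m) ^ 2)) =
      -(μ * inner ℝ (y - ξ) η) - ρ + (inner ℝ (F y) p' - ρ * ‖F y‖ + m ^ 2 / (2 * θ)) := by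
    field_simp
  rw [e3] at h4
  linarith

end Comparison

theorem exists_growth_const {E V : Type*} [NormedAddCommGroup E] [NormedAddCommGroup V]
    {F : E → E} {B : E → V} {L : ℝ} (hFB : ∀ x y : E, ‖F x - F y‖ + ‖B x - B y‖ ≤ L * ‖x - y‖) :
    ∃ c : ℝ, 0 ≤ c ∧ (∀ x y, ‖F x - F y‖ ≤ c * ‖x - y‖) ∧ (∀ x y, ‖B x - B y‖ ≤ c * ‖x - y‖) ∧
      (∀ x, ‖F x‖ ≤ c * (1 + ‖x‖)) ∧ ∀ x, ‖B x‖ ≤ c * (1 + ‖x‖) := by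
  set c : ℝ := |L| + ‖F 0‖ + ‖B 0‖ with hc
  have hc0 : 0 ≤ c := by positivity
  have hLc : ∀ x y : E, L * ‖x - y‖ ≤ c * ‖x - y‖ := fun x y => by
    gcongr
    have := le_abs_self L
    have := norm_nonneg (F 0)
    have := norm_nonneg (B 0)
    linarith
  have hF : ∀ x y, ‖F x - F y‖ ≤ L * ‖x - y‖ := fun x y => by
    have := hFB x y
    have := norm_nonneg (B x - B y)
    linarith
  have hB : ∀ x y, ‖B x - B y‖ ≤ L * ‖x - y‖ := fun x y => by
    have := hFB x y
    have := norm_nonneg (F x - F y)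
    linarith
  have hLx : ∀ x : E, L * ‖x‖ ≤ |L| * ‖x‖ := fun x => by
    gcongr
    exact le_abs_self L
  refine ⟨c, hc0, fun x y => (hF x y).trans (hLc x y), fun x y => (hB x y).trans (hLc x y),
    fun x => ?_, fun x => ?_⟩
  · have h1 := hF x 0
    have h2 := norm_le_norm_add_norm_sub' (F x) (F 0)
    rw [sub_zero] at h1
    have h3 : 0 ≤ (‖F 0‖ + ‖B 0‖) * ‖x‖ := by positivity
    have := hLx x
    have := norm_nonneg (B 0)
    have := abs_nonneg L
    linarith
  · have h1 := hB x 0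
    have h2 := norm_le_norm_add_norm_sub' (B x) (B 0)
    rw [sub_zero] at h1
    have h3 : 0 ≤ (‖F 0‖ + ‖B 0‖) * ‖x‖ := by positivity
    have := hLx x
    have := norm_nonneg (F 0)
    have := abs_nonneg L
    linarith

theorem continuous_of_norm_sub_le {E V : Type*} [NormedAddCommGroup E] [NormedAddCommGroup V]
    {B : E → V} {c : ℝ} (hB : ∀ x y, ‖B x - B y‖ ≤ c * ‖x - y‖) : Continuous B :=
  (LipschitzWith.of_dist_le' (K := c) fun x y => by
    simpa [dist_eq_norm] using hB x y).continuous

end HilbertHJ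

/-! ### Choice of constants and conclusion. -/

open HilbertHJ in
theorem theorem5p1 {E U : Type*}
    [NormedAddCommGroup E] [InnerProductSpace ℝ E] [CompleteSpace E]
    [TopologicalSpace.SeparableSpace E]
    [NormedAddCommGroup U] [InnerProductSpace ℝ U] [CompleteSpace U]
    [TopologicalSpace.SeparableSpace U]
    (C : Set (E × E)) (hC : HilbertHJ.IsMDissipative C)
    (hdense : Dense (HilbertHJ.domain C)) (hzero : ((0 : E), (0 : E)) ∈ C)
    (F : E → E) (B : E → U →L[ℝ] E)
    (hFB : ∃ L : ℝ, ∀ x y : E, ‖F x - F y‖ + ‖B x - B y‖ ≤ L * ‖x - y‖)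
    (α : ℝ) (hα : 0 < α)
    (h : E → ℝ) (hbdd : ∃ M : ℝ, ∀ x, |h x| ≤ M) (hunif : UniformContinuous h)
    (fsub fsuper : E → ℝ)
    (hsub : HilbertHJ.IsSubsolution (HilbertHJ.opHat₀ C F B) α h fsub)
    (hsuper : HilbertHJ.IsSupersolution (HilbertHJ.opHat₁ C F B) α h fsuper) :
    ∀ x : E, fsub x ≤ fsuper x := by
  intro w
  by_contra! hw
  obtain ⟨L, hL⟩ := hFB
  obtain ⟨c, hc, hF, hB, hF', hB'⟩ := exists_growth_const hL
  obtain ⟨Mh, hMh⟩ := hbdd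
  obtain ⟨Mu, hMu⟩ := hsub.bounded
  obtain ⟨Mv, hMv⟩ := hsuper.bounded
  have hMh0 : 0 ≤ Mh := (abs_nonneg _).trans (hMh 0)
  have hMu0 : 0 ≤ Mu := (abs_nonneg _).trans (hMu 0)
  have hMv0 : 0 ≤ Mv := (abs_nonneg _).trans (hMv 0)
  set γ : ℝ := (fsub w - fsuper w) / 4 with hγ
  have hγ0 : 0 < γ := by rw [hγ]; linarith
  set M : ℝ := Mh + Mu + Mv + 1 with hM
  have hM0 : 0 < M := by positivity
  -- Replacing `fsuper` and `h` by their multiples with θ = 1 - τ changes each by at most `γ`, a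
  -- quarter of the assumed gap at `w`.
  set τ : ℝ := min (1 / 2) (γ / M) with hτ
  have hτ0 : 0 < τ := by positivity
  have hτ1 : τ ≤ 1 / 2 := min_le_left _ _
  have hτM : τ * M ≤ γ := (le_div_iff₀ hM0).1 (min_le_right _ _)
  have hτγ : ∀ {a : ℝ}, |a| ≤ M → τ * |a| ≤ γ := fun ha =>
    (mul_le_mul_of_nonneg_left ha hτ0.le).trans hτM
  set θ : ℝ := 1 - τ with hθ
  have hθ0 : 0 < θ := by rw [hθ]; linarith
  have hθ1 : θ < 1 := by rw [hθ]; linarith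
  obtain ⟨δh, hδh, hh⟩ := Metric.uniformContinuous_iff.1 hunif (γ / 4) (by positivity)
  set K : ℝ := 1 + 2 * (c + 1) + (2 * (c + 1)) ^ 2 / (2 * (1 - θ)) with hK
  have hK0 : 0 < K := by
    have : 0 < 1 - θ := by linarith
    positivity
  obtain ⟨δ, hδ0, hδ⟩ := exists_between
    (show 0 < min (min 1 δh) (min (γ / 4) (γ / (4 * (α * K)))) by positivity)
  simp only [lt_min_iff] at hδ
  obtain ⟨⟨hδ1, hδδh⟩, hδγ, hδK⟩ := hδ
  have hvM : ∀ x, |θ * fsuper x| ≤ M := fun x => by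
    rw [abs_mul, abs_of_pos hθ0]
    have := mul_le_of_le_one_left (abs_nonneg (fsuper x)) hθ1.le
    linarith [hMv x]
  have hvlsc : LowerSemicontinuous fun x => θ * fsuper x := fun x r hr => by
    have h1 := hsuper.lsc x (r / θ) ((div_lt_iff₀' hθ0).2 hr)
    filter_upwards [h1] with y hy
    exact (div_lt_iff₀' hθ0).1 hy
  obtain ⟨μ, κ, R, R', hμ, hκ, hR, hR', x₁, y₁, ξ₁, hξ₁, hpen⟩ :=
    hC.exists_penalization hdense (u := fsub) (v := fun x => θ * fsuper x) (M := M)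
      (fun x => (hMu x).trans (by linarith)) hvM hδ0 hδ1.le
  -- One choice that makes ρ(R + 2) and ρc(1 + R') both at most `δ`.
  set ρ : ℝ := δ / (R + 2 + c * (1 + R')) with hρ
  have hρ0 : 0 < ρ := by positivity
  have hρδ : ρ * (R + 2 + c * (1 + R')) = δ := by rw [hρ]; field_simp
  obtain ⟨x, y, ξ, hξ, hge, hmax⟩ := hC.exists_doubling_max hdense hsub.usc hvlsc
    (fun x => (hMu x).trans (by linarith)) hvM hμ hκ hρ0 x₁ y₁ hξ₁
  obtain ⟨hxy, hxy', he, hx, hy, hval⟩ := hpen x y ξ hge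
  obtain ⟨η, hη, hlim⟩ := hC.exists_tendsto_yosida hξ
  have hin := hC.inner_le_of_near_max hzero (x := x) (y := y) hμ.le hκ.le hρ0.le hξ hlim
    fun ζ hζ => by
      have := hmax x y ζ hζ
      simp only [tataruDist_self] at this
      linarith
  have hρle : ∀ {a : ℝ}, a ≤ R + 2 + c * (1 + R') → ρ * a ≤ δ := fun ha =>
    (mul_le_mul_of_nonneg_left ha hρ0.le).trans_eq hρδ
  have hcR : 0 ≤ c * (1 + R') := by positivity
  have hcle : ∀ {a : ℝ}, a ≤ R' → c * (1 + a) ≤ R + 2 + c * (1 + R') := fun ha => by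
    have := mul_le_mul_of_nonneg_left ha hc
    linarith
  have key := sub_le_of_doubling_max (continuous_of_norm_sub_le hF) (continuous_of_norm_sub_le hB)
    hc hF hB hF' hB' hsub hsuper hμ hρ0 hδ1.le hθ0 hθ1 hξ hη hin hmax hxy hxy' he
    (hρle (by linarith)) (hρle (hcle hx)) (hρle (hcle hy))
  have hKδ : δ + 2 * (c + 1) * δ + (2 * (c + 1) * δ) ^ 2 / (2 * (1 - θ)) ≤ K * δ := by
    have h1 : 0 ≤ (2 * (c + 1)) ^ 2 / (2 * (1 - θ)) :=
      div_nonneg (sq_nonneg _) (by linarith)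
    have h2 := mul_le_mul_of_nonneg_left (pow_le_of_le_one hδ0.le hδ1.le two_ne_zero) h1
    rw [mul_pow, mul_div_right_comm, hK]
    linarith
  have hαK : α * (K * δ) < γ / 4 := by
    have h1 := (lt_div_iff₀ (by positivity)).1 hδK
    linarith
  have hmain : fsub x - θ * fsuper y - (h x - θ * h y) ≤ α * (K * δ) := by
    have := key.trans hKδ
    rwa [inv_mul_le_iff₀ hα] at this
  have h1 := hh (show dist x y < δh by rw [dist_eq_norm]; linarith)
  rw [Real.dist_eq] at h1
  have h2 := le_abs_self (h x - h y)
  have h3 := hval w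
  have h4 := hτγ (show |h y| ≤ M by linarith [hMh y])
  have h5 := hτγ (show |fsuper w| ≤ M by linarith [hMv w])
  have h6 := mul_le_mul_of_nonneg_left (le_abs_self (h y)) hτ0.le
  have h7 := mul_le_mul_of_nonneg_left (neg_abs_le (fsuper w)) hτ0.le
  have h8 : θ * h y = h y - τ * h y := by rw [hθ]; ring
  have h9 : θ * fsuper w = fsuper w - τ * fsuper w := by rw [hθ]; ring
  rw [h8] at hmain
  simp only [h9] at h3
  -- The left side of `h3` is at least 4γ - γ - γ/4, while `hmain` and the modulus of continuity of
  -- `h` bound the right side by γ/4 + γ + γ/4.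
  linarith
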